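/- Let $k$ be a field, let $G$ be a finite subgroup of $GL(n,k)$ consisting of diagonal matrices with $\operatorname{char} k\nmid |G|$, and let $\widehat G=\operatorname{Hom}(G,k^*)$. Let $\mathcal C$ be a category with an $\mathbb N$-grading, i.e. a functor $l:\mathcal C\to\mathbb N$ ($\mathbb N$ viewed as a category with one object), and suppose that $\mathcal C$ is indiscretely based: in each connected component of the wide subcategory $\mathcal C_0$ of morphisms of length $0$ there is exactly one morphism between any two objects. Let $k\mathcal C$ be the category algebra (the $k$-vector space with basis the morphisms of $\mathcal C$, with $\alpha\beta=\alpha\circ\beta$ if $\alpha,\beta$ are composable and $0$ otherwise; it is non-unital if $\mathcal C$ has infinitely many objects), graded by length. Let $\deg:\mathcal C\to\widehat G$ be a $\widehat G$-grading, i.e. a functor to $\widehat G$ viewed as a category with one object, and let $G$ act on $k\mathcal C$ by $k$-algebra automorphisms such that $$g\cdot f=\deg(f)(g^{-1})\,f\qquad\text{for all } g\in G,\ f\in\operatorname{Mor}(\mathcal C).$$ Let $k\mathcal C\# G$ be the skew group algebra: the vector space $k\mathcal C\otimes_k k[G]$ with $(a\otimes g)(b\otimes h)=a\,g(b)\otimes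 gh$, graded by $(k\mathcal C\# G)_n=(k\mathcal C)_n\otimes_k k[G]$. A positively graded algebra $A=\bigoplus_{j\ge 0}A_j$ (not necessarily unital) is called Koszul if $A_0$ is semisimple (as a left module over itself) and the graded left $A$-module $A_0=A/A_{>0}$ has a graded projective resolution $\cdots\to P^1\to P^0\to A_0\to 0$ such that $P^i$ is generated by its component of degree $i$, i.e. $P^i=AP^i_i$. Then $k\mathcal C$ is Koszul if and only if $k\mathcal C\# G$ is Koszul. -/

import Mathlib

open CategoryTheory
open scoped MatrixGroups

universe u v w

noncomputable section

namespace KoszulCategory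

/-! ### Graded algebras without unit, graded modules, Koszulity

A category with infinitely many objects has a category algebra without unit, so everything is
set up for associative algebras `A` over a field `k` that need not have a unit.  A left module
over such an `A` is the same thing as a left module over its unitization `k × A`. -/

section Koszul

variable {k : Type w} [Field k] {A : Type u} [NonUnitalRing A] [Module k A]
  [IsScalarTower k A A] [SMulCommClass k A A]

/-- `A = ⨁_{n ≥ 0} 𝒜 n` with `𝒜 m * 𝒜 n ⊆ 𝒜 (m + n)`. -/
structure IsPositivelyGraded (𝒜 : ℕ → Submodule k A) : Prop where
  isInternal : DirectSum.IsInternal 𝒜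
  mul_mem : ∀ {m n : ℕ} {a b : A}, a ∈ 𝒜 m → b ∈ 𝒜 n → a * b ∈ 𝒜 (m + n)

/-- A `ℤ`-graded left `A`-module. -/
structure GradedLeftModule (𝒜 : ℕ → Submodule k A) where
  carrier : Type u
  [addCommGroup : AddCommGroup carrier]
  [moduleBase : Module k carrier]
  [module : Module (Unitization k A) carrier]
  [isScalarTower : IsScalarTower k (Unitization k A) carrier]
  deg : ℤ → Submodule k carrier
  isInternal : DirectSum.IsInternal deg
  smul_mem : ∀ {m : ℕ} {j : ℤ} {a : A} {x : carrier}, a ∈ 𝒜 m → x ∈ deg j →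
    (a : Unitization k A) • x ∈ deg (m + j)

namespace GradedLeftModule

variable {𝒜 : ℕ → Submodule k A}

instance : CoeSort (GradedLeftModule 𝒜) (Type u) := ⟨carrier⟩

attribute [instance] addCommGroup moduleBase module isScalarTower

/-- Homogeneous `A`-linear maps of degree zero. -/
structure Hom (M N : GradedLeftModule 𝒜) where
  toLinearMap : M →ₗ[Unitization k A] N
  map_deg : ∀ {j : ℤ} {x : M}, x ∈ M.deg j → toLinearMap x ∈ N.deg j

/-- `M = A M_i`: every element of `M` is a sum of products `a x` with `a ∈ A`, `x ∈ M_i`. -/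
def IsGeneratedInDegree (M : GradedLeftModule 𝒜) (i : ℤ) : Prop :=
  AddSubgroup.closure {z : M | ∃ a : A, ∃ x ∈ M.deg i, z = (a : Unitization k A) • x} = ⊤

end GradedLeftModule

/-- A graded projective resolution `⋯ → P 2 → P 1 → P 0 → M → 0` in which `P i` is generated
by its component of degree `i`. -/
structure LinearProjectiveResolution {𝒜 : ℕ → Submodule k A} (M : GradedLeftModule 𝒜) where
  P : ℕ → GradedLeftModule 𝒜
  projective : ∀ i, Module.Projective (Unitization k A) (P i)
  d : ∀ i, GradedLeftModule.Hom (P (i + 1)) (P i)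
  ε : GradedLeftModule.Hom (P 0) M
  exact_d : ∀ i, Function.Exact (d (i + 1)).toLinearMap (d i).toLinearMap
  exact_zero : Function.Exact (d 0).toLinearMap ε.toLinearMap
  surjective : Function.Surjective ε.toLinearMap
  generated : ∀ i, (P i).IsGeneratedInDegree i

namespace IsPositivelyGraded

variable {𝒜 : ℕ → Submodule k A} (h : IsPositivelyGraded 𝒜)

lemma bijective (h : IsPositivelyGraded 𝒜) : Function.Bijective (DirectSum.coeLinearMap 𝒜) :=
  h.isInternal

/-- The projection of `A` onto its component of degree zero. -/
def projZero : A →ₗ[k] 𝒜 0 :=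
  DirectSum.component k ℕ (fun n => 𝒜 n) 0 ∘ₗ
    (LinearEquiv.ofBijective (DirectSum.coeLinearMap 𝒜) h.bijective).symm.toLinearMap

lemma projZero_of_mem_zero {a : A} (ha : a ∈ 𝒜 0) : h.projZero a = ⟨a, ha⟩ := by
  have : (LinearEquiv.ofBijective (DirectSum.coeLinearMap 𝒜) h.bijective).symm a =
      DirectSum.lof k ℕ (fun n => 𝒜 n) 0 ⟨a, ha⟩ := by
    rw [LinearEquiv.symm_apply_eq]
    simp
  simp [projZero, this, DirectSum.component.lof_self]

lemma projZero_of_mem_ne {n : ℕ} (hn : n ≠ 0) {a : A} (ha : a ∈ 𝒜 n) : h.projZero a = 0 := by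
  have : (LinearEquiv.ofBijective (DirectSum.coeLinearMap 𝒜) h.bijective).symm a =
      DirectSum.lof k ℕ (fun n => 𝒜 n) n ⟨a, ha⟩ := by
    rw [LinearEquiv.symm_apply_eq]
    simp
  simp [projZero, this, DirectSum.component.of, hn]

lemma induction (h : IsPositivelyGraded 𝒜) {p : A → Prop} (hp : ∀ n, ∀ a ∈ 𝒜 n, p a) (h0 : p 0)
    (hadd : ∀ a b, p a → p b → p (a + b)) (a : A) : p a := by
  have htop : a ∈ (⨆ n, 𝒜 n) := by
    rw [h.isInternal.submodule_iSup_eq_top]; trivial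
  exact Submodule.iSup_induction 𝒜 (motive := p) htop hp h0 hadd

lemma projZero_mul (a b : A) :
    (h.projZero (a * b) : A) = (h.projZero a : A) * (h.projZero b : A) := by
  induction a using h.induction with
  | h0 => simp
  | hadd x y hx hy => simp [add_mul, hx, hy]
  | hp m x hx =>
    induction b using h.induction with
    | h0 => simp
    | hadd y z hy hz => simp [mul_add, hy, hz]
    | hp n y hy =>
      have hxy := h.mul_mem hx hy
      rcases eq_or_ne m 0 with rfl | hm
      · rcases eq_or_ne n 0 with rfl | hn
        · rw [h.projZero_of_mem_zero hx, h.projZero_of_mem_zero hy,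
            h.projZero_of_mem_zero (by simpa using hxy)]
        · rw [h.projZero_of_mem_ne hn hy, h.projZero_of_mem_ne (by omega) hxy]
          simp
      · rw [h.projZero_of_mem_ne hm hx, h.projZero_of_mem_ne (by omega) hxy]
        simp

/-- The left action of `A` on `A₀ = A / A_{> 0}`: `a` acts as left multiplication by its component
of degree zero. -/
def actZero : A →ₙₐ[k] Module.End k (𝒜 0) where
  toFun a :=
    { toFun := fun x => ⟨(h.projZero a : A) * x, by
        simpa using h.mul_mem (h.projZero a).2 x.2⟩
      map_add' := fun x y => by ext; simp [mul_add]
      map_smul' := fun c x => by ext; simp [mul_smul_comm] }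
  map_smul' c a := by ext x; simp [smul_mul_assoc]
  map_zero' := by ext x; simp
  map_add' a b := by ext x; simp [add_mul]
  map_mul' a b := by ext x; simp [h.projZero_mul, mul_assoc]

/-- `A₀` as a graded left `A`-module, concentrated in degree zero. -/
def degreeZero : GradedLeftModule 𝒜 :=
  letI : Module (Unitization k A) (𝒜 0) :=
    Module.compHom (𝒜 0) (Unitization.lift h.actZero).toRingHom
  haveI : IsScalarTower k (Unitization k A) (𝒜 0) :=
    ⟨fun c r x => by
      change (Unitization.lift h.actZero) (c • r) x = c • (Unitization.lift h.actZero) r x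
      simp⟩
  { carrier := 𝒜 0
    deg := fun j => if j = 0 then ⊤ else ⊥
    isInternal := by
      rw [DirectSum.isInternal_submodule_iff_iSupIndep_and_iSup_eq_top]
      constructor
      · intro i
        rcases eq_or_ne i 0 with rfl | hi
        · have : (⨆ j : ℤ, ⨆ _ : j ≠ 0, (if j = 0 then (⊤ : Submodule k (𝒜 0)) else ⊥)) = ⊥ := by
            simp only [iSup_eq_bot]
            intro j hj
            simp [hj]
          rw [this]
          exact disjoint_bot_right
        · simp [hi]
      · exact top_le_iff.mp (le_iSup_of_le (0 : ℤ) (by simp))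
    smul_mem := by
      intro m j a x ha hx
      change (Unitization.lift h.actZero) (a : Unitization k A) x ∈ _
      have hinr : Unitization.lift h.actZero (a : Unitization k A) = h.actZero a := by simp
      rw [hinr]
      rcases eq_or_ne j 0 with rfl | hj
      · rcases eq_or_ne m 0 with rfl | hm
        · simp
        · have : h.actZero a = 0 := by
            ext y
            simp [actZero, h.projZero_of_mem_ne hm ha]
          simp [this]
      · have : x = 0 := by simpa [hj] using hx
        subst this
        simp }

end IsPositivelyGraded

/-- `A` with the grading `𝒜` is Koszul: it is positively graded, `A₀` is semisimple (as a left
module over itself, equivalently over `A`, which acts through its quotient `A₀`), and the graded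
left module `A₀` has a graded projective resolution whose `i`-th term is generated by its
component of degree `i`. -/
def IsKoszul (𝒜 : ℕ → Submodule k A) : Prop :=
  ∃ h : IsPositivelyGraded 𝒜,
    IsSemisimpleModule (Unitization k A) h.degreeZero ∧
      Nonempty (LinearProjectiveResolution h.degreeZero)

end Koszul

/-! ### Category algebras -/

section Category

variable (C : Type u) [Category.{v} C]

/-- The morphisms of a category. -/
structure Mor where
  {src : C}
  {tgt : C}
  hom : src ⟶ tgt

variable {C}

open Classical in
/-- The composite `α ∘ β`, when `α` and `β` are composable. -/
def Mor.comp? (α β : Mor C) : Option (Mor C) :=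
  if h : β.tgt = α.src then some ⟨β.hom ≫ eqToHom h ≫ α.hom⟩ else none

/-- The degree of a morphism for a grading of `C` by a monoid `M`, that is, for a functor from
`C` to `M` viewed as a category with one object. -/
def gradingDeg {M : Type w} [Monoid M] (F : C ⥤ SingleObj M) (f : Mor C) : M := F.map f.hom

/-- The length of a morphism for an `ℕ`-grading. -/
def length (l : C ⥤ SingleObj (Multiplicative ℕ)) (f : Mor C) : ℕ :=
  Multiplicative.toAdd (gradingDeg l f)

lemma gradingDeg_id {M : Type w} [Monoid M] (F : C ⥤ SingleObj M) (x : C) :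
    gradingDeg F ⟨𝟙 x⟩ = 1 := F.map_id x

lemma gradingDeg_comp {M : Type w} [Monoid M] (F : C ⥤ SingleObj M) {x y z : C}
    (f : x ⟶ y) (g : y ⟶ z) :
    gradingDeg F ⟨f ≫ g⟩ = gradingDeg F ⟨g⟩ * gradingDeg F ⟨f⟩ := F.map_comp f g

/-- The morphisms of length zero. -/
def lengthZero (l : C ⥤ SingleObj (Multiplicative ℕ)) : MorphismProperty C :=
  fun _ _ f => length l ⟨f⟩ = 0

instance (l : C ⥤ SingleObj (Multiplicative ℕ)) : (lengthZero l).IsMultiplicative where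
  id_mem x := by simp [lengthZero, length, gradingDeg_id]
  comp_mem f g hf hg := by
    simp only [lengthZero, length] at hf hg ⊢
    simp [gradingDeg_comp, hf, hg]

/-- An indiscrete category: exactly one morphism between any two objects. -/
def IsIndiscrete (D : Type u) [Category.{v} D] : Prop :=
  ∀ X Y : D, Nonempty (Unique (X ⟶ Y))

/-- An `ℕ`-graded category is indiscretely based if each connected component of its wide
subcategory of morphisms of length zero is indiscrete. -/
def IsIndiscretelyBased (l : C ⥤ SingleObj (Multiplicative ℕ)) : Prop :=
  ∀ c : ConnectedComponents (WideSubcategory (lengthZero l)), IsIndiscrete c.Component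

variable (k : Type w) [Field k] (C)

/-- The category algebra `k C`: the vector space with basis the morphisms of `C`, with the product
of two morphisms `α`, `β` equal to `α ∘ β` if they are composable and to `0` otherwise. -/
def CategoryAlgebra : Type (max u v w) := Mor C →₀ k

namespace CategoryAlgebra

instance : AddCommGroup (CategoryAlgebra C k) := inferInstanceAs (AddCommGroup (Mor C →₀ k))
instance : Module k (CategoryAlgebra C k) := inferInstanceAs (Module k (Mor C →₀ k))

/-- The basis of `k C` given by the morphisms of `C`. -/
def basis : Module.Basis (Mor C) k (CategoryAlgebra C k) := ⟨LinearEquiv.refl k (Mor C →₀ k)⟩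

variable {C} in
/-- The basis vector of a morphism. -/
def of (f : Mor C) : CategoryAlgebra C k := basis C k f

/-- The multiplication, as a bilinear map. -/
def mulₗ : CategoryAlgebra C k →ₗ[k] CategoryAlgebra C k →ₗ[k] CategoryAlgebra C k :=
  (basis C k).constr k fun α => (basis C k).constr k fun β => (α.comp? β).elim 0 (of k)

instance : Mul (CategoryAlgebra C k) := ⟨fun a b => mulₗ C k a b⟩

variable {C k}

lemma mul_def (a b : CategoryAlgebra C k) : a * b = mulₗ C k a b := rfl

lemma of_mul_of (α β : Mor C) :
    of k α * of k β = (α.comp? β).elim 0 (of k) := by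
  simp [mul_def, mulₗ, of, Module.Basis.constr_basis]

lemma induction {p : CategoryAlgebra C k → Prop} (h0 : p 0)
    (hadd : ∀ a b, p a → p b → p (a + b)) (hof : ∀ (c : k) (f : Mor C), p (c • of k f))
    (a : CategoryAlgebra C k) : p a := by
  rw [← (basis C k).linearCombination_repr a, Finsupp.linearCombination_apply]
  exact Finset.sum_induction _ p hadd h0 fun f _ => hof _ f

protected lemma zero_mul (a : CategoryAlgebra C k) : 0 * a = 0 := by simp [mul_def]

protected lemma mul_zero (a : CategoryAlgebra C k) : a * 0 = 0 := by simp [mul_def]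

lemma of_mul_assoc (α β γ : Mor C) :
    of k α * of k β * of k γ = of k α * (of k β * of k γ) := by
  rcases α with @⟨a₁, a₂, f⟩
  rcases β with @⟨b₁, b₂, g⟩
  rcases γ with @⟨c₁, c₂, h⟩
  by_cases h₁ : b₂ = a₁ <;> by_cases h₂ : c₂ = b₁
  all_goals (try subst h₁); (try subst h₂)
  all_goals simp [of_mul_of, Mor.comp?, CategoryAlgebra.zero_mul, CategoryAlgebra.mul_zero, *]

instance : IsScalarTower k (CategoryAlgebra C k) (CategoryAlgebra C k) :=
  ⟨fun c a b => by simp [mul_def]⟩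

instance : SMulCommClass k (CategoryAlgebra C k) (CategoryAlgebra C k) :=
  ⟨fun c a b => by simp [mul_def]⟩

instance : NonUnitalRing (CategoryAlgebra C k) where
  left_distrib a b c := by simp [mul_def]
  right_distrib a b c := by simp [mul_def]
  zero_mul a := by simp [mul_def]
  mul_zero a := by simp [mul_def]
  mul_assoc a b c := by
    have hs : ∀ (r : k) (x y : CategoryAlgebra C k), (r • x) * y = r • (x * y) :=
      fun r x y => by simp [mul_def]
    have hs' : ∀ (r : k) (x y : CategoryAlgebra C k), x * (r • y) = r • (x * y) :=
      fun r x y => by simp [mul_def]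
    induction a using induction with
    | h0 => simp [mul_def]
    | hadd x y hx hy => simp only [mul_def, map_add, LinearMap.add_apply] at *; rw [hx, hy]
    | hof r f =>
      induction b using induction with
      | h0 => simp [mul_def]
      | hadd x y hx hy => simp only [mul_def, map_add, LinearMap.add_apply] at *; rw [hx, hy]
      | hof s g =>
        induction c using induction with
        | h0 => simp [mul_def]
        | hadd x y hx hy => simp only [mul_def, map_add] at *; rw [hx, hy]
        | hof t h => simp only [hs, hs', of_mul_assoc]

end CategoryAlgebra

variable {C}

/-- The grading of the category algebra by length: the component of degree `n` is spanned by the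
morphisms of length `n`. -/
def lengthGrading (l : C ⥤ SingleObj (Multiplicative ℕ)) (n : ℕ) :
    Submodule k (CategoryAlgebra C k) :=
  Submodule.span k (CategoryAlgebra.of k '' {f : Mor C | length l f = n})

end Category

/-! ### Skew group algebras -/

section Skew

variable (k : Type w) [Field k] (G : Type v) [Group G] (A : Type u) [NonUnitalRing A] [Module k A]

/-- An action of `G` on `A` by `k`-algebra automorphisms. -/
structure AlgebraAction where
  toHom : G →* (A ≃ₗ[k] A)
  map_mul : ∀ (g : G) (a b : A), toHom g (a * b) = toHom g a * toHom g b

variable {k G A}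

/-- The skew group algebra `A # G`.  The underlying vector space is `A ⊗ k[G]`, realized as the
space of finitely supported functions `G → A`; the function `Finsupp.single g a` is `a ⊗ g`. -/
@[nolint unusedArguments]
def SkewGroupAlgebra (_φ : AlgebraAction k G A) : Type (max u v) := G →₀ A

namespace SkewGroupAlgebra

variable (φ : AlgebraAction k G A)

instance : AddCommGroup (SkewGroupAlgebra φ) := inferInstanceAs (AddCommGroup (G →₀ A))
instance : Module k (SkewGroupAlgebra φ) := inferInstanceAs (Module k (G →₀ A))

/-- The identification with the space of finitely supported functions. -/
def toFinsupp : SkewGroupAlgebra φ ≃ₗ[k] (G →₀ A) := LinearEquiv.refl k (G →₀ A)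

/-- The element `a ⊗ g`. -/
def tmul (a : A) (g : G) : SkewGroupAlgebra φ := (toFinsupp φ).symm (Finsupp.single g a)

/-- `(a ⊗ g) (b ⊗ h) = a g(b) ⊗ g h`, extended by linearity. -/
instance : Mul (SkewGroupAlgebra φ) :=
  ⟨fun x y => (toFinsupp φ x).sum fun g a => (toFinsupp φ y).sum fun h b =>
    tmul φ (a * φ.toHom g b) (g * h)⟩

variable {φ}

lemma mul_def (x y : SkewGroupAlgebra φ) : x * y =
    (toFinsupp φ x).sum fun g a => (toFinsupp φ y).sum fun h b =>
      tmul φ (a * φ.toHom g b) (g * h) := rfl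

lemma tmul_zero (g : G) : tmul φ 0 g = 0 := by simp [tmul]

lemma tmul_add (a b : A) (g : G) : tmul φ (a + b) g = tmul φ a g + tmul φ b g := by
  simp [tmul]

lemma smul_tmul (c : k) (a : A) (g : G) : c • tmul φ a g = tmul φ (c • a) g := by
  simp only [tmul, ← Finsupp.smul_single, map_smul]

lemma tmul_mul_tmul (a b : A) (g h : G) :
    tmul φ a g * tmul φ b h = tmul φ (a * φ.toHom g b) (g * h) := by
  rw [mul_def]
  simp [tmul, Finsupp.sum_single_index]

lemma induction {p : SkewGroupAlgebra φ → Prop} (h0 : p 0)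
    (hadd : ∀ a b, p a → p b → p (a + b)) (ht : ∀ a g, p (tmul φ a g))
    (x : SkewGroupAlgebra φ) : p x := by
  obtain ⟨y, rfl⟩ := (toFinsupp φ).symm.surjective x
  induction y using Finsupp.induction_linear with
  | zero => simpa using h0
  | add y z hy hz => simpa using hadd _ _ hy hz
  | single g a => exact ht a g

protected lemma add_mul (x y z : SkewGroupAlgebra φ) : (x + y) * z = x * z + y * z := by
  simp only [mul_def, map_add]
  refine Finsupp.sum_add_index' (fun g => ?_) fun g a b => ?_
  · simp [tmul_zero]
  · simp only [add_mul, tmul_add, Finsupp.sum_add]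

protected lemma mul_add (x y z : SkewGroupAlgebra φ) : x * (y + z) = x * y + x * z := by
  simp only [mul_def, map_add]
  rw [← Finsupp.sum_add]
  refine Finsupp.sum_congr fun g _ => ?_
  refine Finsupp.sum_add_index' (fun h => ?_) fun h a b => ?_
  · simp [tmul_zero]
  · simp [mul_add, tmul_add]

protected lemma zero_mul (x : SkewGroupAlgebra φ) : 0 * x = 0 := by simp [mul_def]

protected lemma mul_zero (x : SkewGroupAlgebra φ) : x * 0 = 0 := by simp [mul_def]

instance : NonUnitalRing (SkewGroupAlgebra φ) where
  left_distrib := SkewGroupAlgebra.mul_add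
  right_distrib := SkewGroupAlgebra.add_mul
  zero_mul := SkewGroupAlgebra.zero_mul
  mul_zero := SkewGroupAlgebra.mul_zero
  mul_assoc x y z := by
    induction x using induction with
    | h0 => simp only [SkewGroupAlgebra.zero_mul]
    | hadd x x' hx hx' => simp only [SkewGroupAlgebra.add_mul, hx, hx']
    | ht a g =>
      induction y using induction with
      | h0 => simp only [SkewGroupAlgebra.zero_mul, SkewGroupAlgebra.mul_zero]
      | hadd x x' hx hx' =>
        simp only [SkewGroupAlgebra.add_mul, SkewGroupAlgebra.mul_add, hx, hx']
      | ht b h =>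
        induction z using induction with
        | h0 => simp only [SkewGroupAlgebra.mul_zero]
        | hadd x x' hx hx' => simp only [SkewGroupAlgebra.mul_add, hx, hx']
        | ht c i => simp [tmul_mul_tmul, φ.map_mul, mul_assoc]

instance [IsScalarTower k A A] : IsScalarTower k (SkewGroupAlgebra φ) (SkewGroupAlgebra φ) :=
  ⟨fun c x y => by
    simp only [smul_eq_mul]
    induction x using induction with
    | h0 => simp
    | hadd x x' hx hx' => simp [add_mul, hx, hx']
    | ht a g =>
      induction y using induction with
      | h0 => simp
      | hadd x x' hx hx' => simp [mul_add, hx, hx']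
      | ht b h => simp [smul_tmul, tmul_mul_tmul, smul_mul_assoc, mul_smul_comm]⟩

instance [SMulCommClass k A A] : SMulCommClass k (SkewGroupAlgebra φ) (SkewGroupAlgebra φ) :=
  ⟨fun c x y => by
    simp only [smul_eq_mul]
    induction x using induction with
    | h0 => simp
    | hadd x x' hx hx' => simp [add_mul, hx, hx']
    | ht a g =>
      induction y using induction with
      | h0 => simp
      | hadd x x' hx hx' => simp [mul_add, hx, hx']
      | ht b h => simp [smul_tmul, tmul_mul_tmul, smul_mul_assoc, mul_smul_comm]⟩

end SkewGroupAlgebra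

/-- The grading of `A # G` induced by a grading of `A`, with `(A # G)_n = A_n ⊗ k[G]`. -/
def skewGrading (φ : AlgebraAction k G A) (𝒜 : ℕ → Submodule k A) (n : ℕ) :
    Submodule k (SkewGroupAlgebra φ) :=
  Submodule.span k {x | ∃ a ∈ 𝒜 n, ∃ g : G, x = SkewGroupAlgebra.tmul φ a g}

end Skew

end KoszulCategory

end

open KoszulCategory

/-! Write `A` for the category algebra. Morphisms of length zero are invertible and determined by
source and target, so `A₀` is a sum of simple modules `A₀ 1_x`, as in a matrix algebra
(`isSemisimpleModule_degreeZero`). Hence the left side of the equivalence is only a question about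
linear resolutions. Since `g` rescales every morphism, `G` preserves length, and what remains is a
general statement about a graded action on an algebra with enough local identities
(`isKoszul_iff_isKoszul_skewGrading`).

From `A` to `A # G`: induction is exact, preserves generation in degree `i`, and takes `A₀` to `(A #
G)₀`. It therefore carries a linear resolution of `A₀` to one of `(A # G)₀`. Semisimplicity of `(A #
G)₀` is Maschke's theorem: an `A`-linear projection onto a submodule is averaged over `G`, whose
order is invertible in `k` (`isSemisimpleModule_of_restriction`).

From `A # G` to `A`: a linear resolution of `(A # G)₀` restricts to one over `A`, and `A₀` is a
graded direct summand of the restriction of `(A # G)₀`. It remains to see that summands inherit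
linear resolutions (`of_retract`). In a linear resolution `Pⁿ` is generated in degree `n`, and there
the differential out of it (the augmentation, if `n = 0`) is injective, because its kernel is a
quotient of a module living in degrees above `n`. Lifts to the resolution are therefore unique, not
just unique up to homotopy. The idempotent cutting out the summand lifts to a chain map that is
itself idempotent, and its images resolve the summand.

As `A` may lack a unit, modules are taken over its unitization. Two devices replace the unit: a
projective `P` with `P = A P` is a summand of a direct sum of copies of `A`
(`exists_section_of_projective`), and the identities `1_x` decompose `a = ∑ a 1_x`
(`IsRightUnitSystem`). -/

noncomputable section
namespace KoszulCategory

/-! ### Internal gradings of vector spaces -/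

section InternalGrading

variable {k : Type*} [Field k] {ι : Type*} [DecidableEq ι] {M N : Type*} [AddCommGroup M]
  [Module k M] [AddCommGroup N] [Module k N] {D : ι → Submodule k M}

lemma bijective_coeLinearMap (hD : DirectSum.IsInternal D) :
    Function.Bijective (DirectSum.coeLinearMap D) := hD

/-- The linear map that agrees with `f j` on the component of degree `j`. -/
def assemble (hD : DirectSum.IsInternal D) (f : ι → M →ₗ[k] N) : M →ₗ[k] N :=
  DirectSum.toModule k ι N (fun j => f j ∘ₗ (D j).subtype) ∘ₗ
    (LinearEquiv.ofBijective (DirectSum.coeLinearMap D)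
      (bijective_coeLinearMap hD)).symm.toLinearMap

lemma assemble_of_mem (hD : DirectSum.IsInternal D) (f : ι → M →ₗ[k] N) {j : ι} {x : M}
    (hx : x ∈ D j) : assemble hD f x = f j x := by
  have : (LinearEquiv.ofBijective (DirectSum.coeLinearMap D)
      (bijective_coeLinearMap hD)).symm x =
      DirectSum.lof k ι (fun n => D n) j ⟨x, hx⟩ := by
    rw [LinearEquiv.symm_apply_eq]
    simp
  simp [assemble, this, DirectSum.toModule_lof]

/-- The projection onto the component of degree `j`. -/
def component (hD : DirectSum.IsInternal D) (j : ι) : M →ₗ[k] M :=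
  assemble hD fun i => if i = j then LinearMap.id else 0

lemma component_of_mem (hD : DirectSum.IsInternal D) {j : ι} {x : M} (hx : x ∈ D j) :
    component hD j x = x := by
  simp [component, assemble_of_mem hD _ hx]

lemma component_of_mem_ne (hD : DirectSum.IsInternal D) {i j : ι} (hij : i ≠ j) {x : M}
    (hx : x ∈ D i) : component hD j x = 0 := by
  simp [component, assemble_of_mem hD _ hx, hij]

lemma internal_induction [Nonempty ι] (hD : DirectSum.IsInternal D) {p : M → Prop}
    (hp : ∀ n, ∀ a ∈ D n, p a) (hadd : ∀ a b, p a → p b → p (a + b)) (a : M) : p a := by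
  have htop : a ∈ (⨆ n, D n) := by
    rw [hD.submodule_iSup_eq_top]; trivial
  exact Submodule.iSup_induction D (motive := p) htop hp
    (hp (Classical.arbitrary ι) 0 (zero_mem _)) hadd

lemma component_mem (hD : DirectSum.IsInternal D) (j : ι) (x : M) : component hD j x ∈ D j := by
  have : Nonempty ι := ⟨j⟩
  induction x using internal_induction hD with
  | hp i a ha =>
    by_cases hij : i = j
    · subst hij; rwa [component_of_mem hD ha]
    · rw [component_of_mem_ne hD hij ha]; exact zero_mem _
  | hadd a b ha hb => rw [map_add]; exact add_mem ha hb

/-- The sum of the other components lies in the kernel of `π j`, which meets `D j` trivially. The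
target is an arbitrary `N`, so that projections of an ambient space can serve for a submodule. -/
lemma isInternal_of_projections (htop : ⨆ j, D j = ⊤) (π : ι → M →ₗ[k] N)
    (hne : ∀ i j, i ≠ j → ∀ x ∈ D i, π j x = 0) (heq : ∀ j, ∀ x ∈ D j, π j x = 0 → x = 0) :
    DirectSum.IsInternal D := by
  rw [DirectSum.isInternal_submodule_iff_iSupIndep_and_iSup_eq_top]
  refine ⟨fun j => ?_, htop⟩
  have hle : ⨆ i, ⨆ (_ : i ≠ j), D i ≤ LinearMap.ker (π j) :=
    iSup₂_le fun i hij x hx => hne i j hij x hx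
  rw [Submodule.disjoint_def]
  exact fun x hx hx' => heq j x hx (hle hx')

end InternalGrading

/-! ### Modules over the unitization -/

section Unitization

variable {k : Type w} [Field k] {A : Type u} [NonUnitalRing A] [Module k A]
  [IsScalarTower k A A] [SMulCommClass k A A]
  {M N : Type*} [AddCommGroup M] [Module k M] [AddCommGroup N] [Module k N]

/-- The module over the unitization given by an action of the non-unital algebra. -/
abbrev moduleOfAction (ψ : A →ₙₐ[k] Module.End k M) : Module (Unitization k A) M :=
  Module.compHom M (Unitization.lift ψ).toRingHom

lemma isScalarTower_moduleOfAction (ψ : A →ₙₐ[k] Module.End k M) :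
    letI := moduleOfAction ψ
    IsScalarTower k (Unitization k A) M :=
  letI := moduleOfAction ψ
  ⟨fun c r x => by
    change (Unitization.lift ψ) (c • r) x = c • (Unitization.lift ψ) r x
    simp⟩

lemma moduleOfAction_smul (ψ : A →ₙₐ[k] Module.End k M) (a : A) (x : M) :
    letI := moduleOfAction ψ
    (a : Unitization k A) • x = ψ a x := by
  change (Unitization.lift ψ) (a : Unitization k A) x = ψ a x
  simp

variable [Module (Unitization k A) M] [IsScalarTower k (Unitization k A) M]
  [Module (Unitization k A) N] [IsScalarTower k (Unitization k A) N]

lemma inl_smul_eq (c : k) (x : M) : (Unitization.inl c : Unitization k A) • x = c • x := by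
  have : (Unitization.inl c : Unitization k A) = c • 1 := by
    rw [← Unitization.inl_one, ← Unitization.inl_smul, smul_eq_mul, mul_one]
  rw [this, smul_assoc, one_smul]

/-- A `k`-linear map that commutes with the action of `A` is linear over the unitization. -/
def linearOfCommute (f : M →ₗ[k] N)
    (hf : ∀ (a : A) (x : M), f ((a : Unitization k A) • x) = (a : Unitization k A) • f x) :
    M →ₗ[Unitization k A] N where
  toFun := f
  map_add' := f.map_add
  map_smul' r x := by
    induction r using Unitization.ind with
    | inl_add_inr c a => simp [add_smul, inl_smul_eq, hf]

@[simp] lemma linearOfCommute_apply (f : M →ₗ[k] N)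
    (hf : ∀ (a : A) (x : M), f ((a : Unitization k A) • x) = (a : Unitization k A) • f x)
    (x : M) : linearOfCommute f hf x = f x := rfl

lemma map_smul_base (f : M →ₗ[Unitization k A] N) (c : k) (x : M) : f (c • x) = c • f x := by
  rw [← inl_smul_eq (A := A), map_smul, inl_smul_eq]

end Unitization

/-! ### Graded modules -/

namespace GradedLeftModule

variable {k : Type w} [Field k] {A : Type u} [NonUnitalRing A] [Module k A]
  [IsScalarTower k A A] [SMulCommClass k A A] {𝒜 : ℕ → Submodule k A}

@[ext] lemma Hom.ext {M N : GradedLeftModule 𝒜} {f g : Hom M N}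
    (h : ∀ x, f.toLinearMap x = g.toLinearMap x) : f = g := by
  cases f; cases g; congr; exact LinearMap.ext h

/-- Composition of homomorphisms. -/
def Hom.comp {M N K : GradedLeftModule 𝒜} (g : Hom N K) (f : Hom M N) : Hom M K where
  toLinearMap := g.toLinearMap ∘ₗ f.toLinearMap
  map_deg hx := g.map_deg (f.map_deg hx)

@[simp] lemma Hom.comp_apply {M N K : GradedLeftModule 𝒜} (g : Hom N K) (f : Hom M N) (x : M) :
    (g.comp f).toLinearMap x = g.toLinearMap (f.toLinearMap x) := rfl

lemma component_smul (M : GradedLeftModule 𝒜) {m : ℕ} {a : A} (ha : a ∈ 𝒜 m) (j : ℤ) (x : M) :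
    component M.isInternal (m + j) ((a : Unitization k A) • x) =
      (a : Unitization k A) • component M.isInternal j x := by
  induction x using internal_induction M.isInternal with
  | hp i x hx =>
    have hax := M.smul_mem ha hx
    by_cases hij : i = j
    · subst hij
      rw [component_of_mem _ hx, component_of_mem _ hax]
    · rw [component_of_mem_ne _ hij hx, component_of_mem_ne _ (by omega) hax, smul_zero]
  | hadd x y hx hy => simp only [smul_add, map_add, hx, hy]

lemma Hom.component_map {M N : GradedLeftModule 𝒜} (f : Hom M N) (j : ℤ) (x : M) :
    component N.isInternal j (f.toLinearMap x) = f.toLinearMap (component M.isInternal j x) := by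
  induction x using internal_induction M.isInternal with
  | hp i x hx =>
    by_cases hij : i = j
    · subst hij
      rw [component_of_mem _ hx, component_of_mem _ (f.map_deg hx)]
    · rw [component_of_mem_ne _ hij hx, component_of_mem_ne _ hij (f.map_deg hx), map_zero]
  | hadd x y hx hy => simp only [map_add, hx, hy]

/-- The homogeneous part of degree zero of a linear map between graded modules. -/
def degreeZeroPart (h : IsPositivelyGraded 𝒜) {M N : GradedLeftModule 𝒜}
    (f : M →ₗ[Unitization k A] N) : Hom M N where
  -- On `M_j` keep only the component of `f` in degree `j`; commutation with `a` of degree `m` holds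
  -- because `a` carries component `j` to component `m + j`.
  toLinearMap := linearOfCommute
    (assemble M.isInternal fun j => component N.isInternal j ∘ₗ
      { toFun := f, map_add' := f.map_add, map_smul' := map_smul_base f })
    (fun a x => by
      induction a using h.induction with
      | h0 => simp
      | hadd a b ha hb => simp only [Unitization.inr_add, add_smul, map_add, ha, hb]
      | hp m a ha =>
        induction x using internal_induction M.isInternal with
        | hp j x hx =>
          rw [assemble_of_mem _ _ hx, assemble_of_mem _ _ (M.smul_mem ha hx)]
          simp [component_smul N ha]
        | hadd x y hx hy => simp only [smul_add, map_add, hx, hy])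
  map_deg {j x} hx := by
    rw [linearOfCommute_apply, assemble_of_mem M.isInternal _ hx]
    exact component_mem N.isInternal _ _

lemma degreeZeroPart_of_mem (h : IsPositivelyGraded 𝒜) {M N : GradedLeftModule 𝒜}
    (f : M →ₗ[Unitization k A] N) {j : ℤ} {x : M} (hx : x ∈ M.deg j) :
    (degreeZeroPart h f).toLinearMap x = component N.isInternal j (f x) :=
  assemble_of_mem M.isInternal _ hx

/-- Projectivity is ungraded, so it yields a lift that need not respect degrees. Its homogeneous
part of degree zero is still a lift, since `d` and `f` commute with taking components. -/
lemma exists_lift (h : IsPositivelyGraded 𝒜) {P X Y : GradedLeftModule 𝒜}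
    [Module.Projective (Unitization k A) P] (d : Hom X Y) (f : Hom P Y)
    (hf : ∀ x, f.toLinearMap x ∈ LinearMap.range d.toLinearMap) :
    ∃ f' : Hom P X, d.comp f' = f := by
  obtain ⟨g, hg⟩ := Module.projective_lifting_property d.toLinearMap.rangeRestrict
    (f.toLinearMap.codRestrict _ hf) d.toLinearMap.surjective_rangeRestrict
  have hg' : ∀ x, d.toLinearMap (g x) = f.toLinearMap x := fun x =>
    congrArg Subtype.val (LinearMap.congr_fun hg x)
  refine ⟨degreeZeroPart h g, Hom.ext fun x => ?_⟩
  induction x using internal_induction P.isInternal with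
  | hp j x hx =>
    rw [Hom.comp_apply, degreeZeroPart_of_mem h g hx, ← Hom.component_map, hg',
      component_of_mem _ (f.map_deg hx)]
  | hadd x y hx hy => simp only [map_add, hx, hy]

lemma IsGeneratedInDegree.induction {M : GradedLeftModule 𝒜} {i : ℤ}
    (hM : M.IsGeneratedInDegree i) {p : M → Prop}
    (hp : ∀ (a : A) (x : M), x ∈ M.deg i → p ((a : Unitization k A) • x))
    (h0 : p 0) (hadd : ∀ x y, p x → p y → p (x + y)) (hneg : ∀ x, p x → p (-x)) (x : M) : p x := by
  have hx : x ∈ AddSubgroup.closure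
      {z : M | ∃ a : A, ∃ x ∈ M.deg i, z = (a : Unitization k A) • x} := by
    rw [show AddSubgroup.closure _ = ⊤ from hM]; trivial
  induction hx using AddSubgroup.closure_induction with
  | mem x hx => obtain ⟨a, y, hy, rfl⟩ := hx; exact hp a y hy
  | zero => exact h0
  | add x y _ _ hx hy => exact hadd x y hx hy
  | neg x _ hx => exact hneg x hx

/-- Elements of `A` have nonnegative degree, so products `a x` with `x` of degree `i` never reach
below `i`. -/
lemma IsGeneratedInDegree.eq_zero_of_lt {M : GradedLeftModule 𝒜} {i : ℤ}
    (hM : M.IsGeneratedInDegree i) (h : IsPositivelyGraded 𝒜) {j : ℤ} (hj : j < i) {x : M}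
    (hx : x ∈ M.deg j) : x = 0 := by
  have key : ∀ y : M, component M.isInternal j y = 0 := fun y => by
    induction y using hM.induction with
    | hp a y hy =>
      induction a using h.induction with
      | h0 => simp
      | hadd a b ha hb => simp only [Unitization.inr_add, add_smul, map_add, ha, hb, add_zero]
      | hp m a ha => exact component_of_mem_ne _ (by omega) (M.smul_mem ha hy)
    | h0 => simp
    | hadd x y hx hy => simp [hx, hy]
    | hneg x hx => simp [hx]
  rw [← component_of_mem M.isInternal hx, key]

/-- A graded map out of `P` is determined by the generators, which land in `X_i`, and there `d` is
injective. This gives strict uniqueness of lifts. -/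
lemma IsGeneratedInDegree.hom_ext {P X Y : GradedLeftModule 𝒜} {i : ℤ}
    (hP : P.IsGeneratedInDegree i) {d : Hom X Y}
    (hd : ∀ x ∈ X.deg i, d.toLinearMap x = 0 → x = 0) {f g : Hom P X}
    (hfg : d.comp f = d.comp g) : f = g := by
  refine Hom.ext fun x => ?_
  induction x using hP.induction with
  | hp a x hx =>
    rw [map_smul, map_smul]
    congr 1
    rw [← sub_eq_zero]
    refine hd _ (sub_mem (f.map_deg hx) (g.map_deg hx)) ?_
    rw [map_sub, sub_eq_zero]
    exact congrArg (fun φ : Hom P Y => φ.toLinearMap x) hfg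
  | h0 => simp
  | hadd x y hx hy => simp [hx, hy]
  | hneg x hx => simp [hx]

/-- The image of an endomorphism of a graded module. -/
def homRange {M : GradedLeftModule 𝒜} (e : Hom M M) :
    GradedLeftModule 𝒜 where
  carrier := LinearMap.range e.toLinearMap
  moduleBase := inferInstanceAs (Module k
    ((LinearMap.range e.toLinearMap).restrictScalars k))
  isScalarTower := inferInstanceAs (IsScalarTower k (Unitization k A)
    ((LinearMap.range e.toLinearMap).restrictScalars k))
  deg j := (M.deg j).comap ((LinearMap.range e.toLinearMap).restrictScalars k).subtype
  isInternal := by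
    refine isInternal_of_projections (N := M) ?_
      (fun j => component M.isInternal j ∘ₗ
        ((LinearMap.range e.toLinearMap).restrictScalars k).subtype)
      (fun i j hij x hx => component_of_mem_ne M.isInternal hij hx)
      (fun j x hx h0 => Subtype.ext ((component_of_mem M.isInternal hx).symm.trans h0))
    rw [eq_top_iff]
    rintro ⟨_, y, rfl⟩ -
    induction y using internal_induction M.isInternal with
    -- The image is spanned by images of homogeneous elements, each of which is homogeneous.
    | hp j y hy => exact Submodule.mem_iSup_of_mem j (e.map_deg hy)
    | hadd y z hy hz =>
      convert add_mem hy hz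
      exact Subtype.ext (map_add e.toLinearMap y z)
  smul_mem ha hx := M.smul_mem ha hx

end GradedLeftModule

/-! ### Direct summands of modules with a linear resolution -/

namespace LinearProjectiveResolution

open GradedLeftModule

variable {k : Type w} [Field k] {A : Type u} [NonUnitalRing A] [Module k A]
  [IsScalarTower k A A] [SMulCommClass k A A] {𝒜 : ℕ → Submodule k A}
  {M N : GradedLeftModule 𝒜}

attribute [local instance] LinearProjectiveResolution.projective

/-- By exactness the kernel is the image of `P (n + 2)`, which vanishes in degree `n + 1` because it
is generated in degree `n + 2`. -/
lemma d_eq_zero_of_mem (R : LinearProjectiveResolution M) (h : IsPositivelyGraded 𝒜) (n : ℕ)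
    (x : R.P (n + 1)) (hx : x ∈ (R.P (n + 1)).deg (n + 1 : ℕ))
    (h0 : (R.d n).toLinearMap x = 0) : x = 0 := by
  obtain ⟨y, rfl⟩ := (R.exact_d n x).1 h0
  rw [← component_of_mem (R.P (n + 1)).isInternal hx, Hom.component_map,
    (R.generated (n + 2)).eq_zero_of_lt h (by push_cast; omega)
      (component_mem (R.P (n + 2)).isInternal _ y), map_zero]

lemma ε_eq_zero_of_mem (R : LinearProjectiveResolution M) (h : IsPositivelyGraded 𝒜)
    (x : R.P 0) (hx : x ∈ (R.P 0).deg (0 : ℕ)) (h0 : R.ε.toLinearMap x = 0) : x = 0 := by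
  obtain ⟨y, rfl⟩ := (R.exact_zero x).1 h0
  rw [← component_of_mem (R.P 0).isInternal hx, Hom.component_map,
    (R.generated 1).eq_zero_of_lt h (by norm_num)
      (component_mem (R.P 1).isInternal _ y), map_zero]

/-- The comparison theorem. The recursion carries maps together with the fact that they preserve the
image of the incoming differential, which is exactly what the next lift requires. -/
lemma exists_chainMap (R : LinearProjectiveResolution M) (h : IsPositivelyGraded 𝒜)
    (e : Hom M M) : ∃ e' : ∀ n, Hom (R.P n) (R.P n), R.ε.comp (e' 0) = e.comp R.ε ∧
      ∀ n, (R.d n).comp (e' (n + 1)) = (e' n).comp (R.d n) := by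
  have step : ∀ n, ∀ f : {f : Hom (R.P n) (R.P n) // ∀ x, f.toLinearMap ((R.d n).toLinearMap x) ∈
      LinearMap.range (R.d n).toLinearMap},
      ∃ g : {f : Hom (R.P (n + 1)) (R.P (n + 1)) // ∀ x, f.toLinearMap
        ((R.d (n + 1)).toLinearMap x) ∈ LinearMap.range (R.d (n + 1)).toLinearMap},
        (R.d n).comp g.1 = f.1.comp (R.d n) := by
    rintro n ⟨f, hf⟩
    obtain ⟨g, hg⟩ := exists_lift h (R.d n) (f.comp (R.d n)) hf
    refine ⟨⟨g, fun x => (R.exact_d n _).1 ?_⟩, hg⟩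
    have := congrArg (fun φ : Hom _ _ => φ.toLinearMap ((R.d (n + 1)).toLinearMap x)) hg
    simp only [Hom.comp_apply] at this
    rw [this, (R.exact_d n).apply_apply_eq_zero, map_zero]
  obtain ⟨e₀, he₀⟩ := exists_lift h R.ε (e.comp R.ε)
    (fun x => LinearMap.range_eq_top.2 R.surjective ▸ Submodule.mem_top)
  choose s hs using step
  have he₀' : ∀ x, e₀.toLinearMap ((R.d 0).toLinearMap x) ∈ LinearMap.range (R.d 0).toLinearMap :=
    fun x => (R.exact_zero _).1 (by
      have := congrArg (fun φ : Hom _ _ => φ.toLinearMap ((R.d 0).toLinearMap x)) he₀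
      simp only [Hom.comp_apply] at this
      rw [this, R.exact_zero.apply_apply_eq_zero, map_zero])
  exact ⟨fun n => (Nat.rec ⟨e₀, he₀'⟩ s n : {f : Hom (R.P n) (R.P n) // ∀ x, f.toLinearMap
    ((R.d n).toLinearMap x) ∈ LinearMap.range (R.d n).toLinearMap}).1, he₀, fun n => hs n _⟩

/-- Both `e' n` and its square lift the same map, and such lifts are unique by linearity of the
resolution. -/
lemma chainMap_idempotent (R : LinearProjectiveResolution M) (h : IsPositivelyGraded 𝒜)
    {e : Hom M M} (he : e.comp e = e) {e' : ∀ n, Hom (R.P n) (R.P n)}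
    (h0 : R.ε.comp (e' 0) = e.comp R.ε)
    (hd : ∀ n, (R.d n).comp (e' (n + 1)) = (e' n).comp (R.d n)) (n : ℕ) :
    (e' n).comp (e' n) = e' n := by
  induction n with
  | zero =>
    refine (R.generated 0).hom_ext (R.ε_eq_zero_of_mem h) ?_
    calc R.ε.comp ((e' 0).comp (e' 0)) = (R.ε.comp (e' 0)).comp (e' 0) := rfl
      _ = (e.comp R.ε).comp (e' 0) := by rw [h0]
      _ = e.comp (R.ε.comp (e' 0)) := rfl
      _ = e.comp (e.comp R.ε) := by rw [h0]
      _ = (e.comp e).comp R.ε := rfl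
      _ = R.ε.comp (e' 0) := by rw [he, h0]
  | succ n ih =>
    refine (R.generated (n + 1)).hom_ext (R.d_eq_zero_of_mem h n) ?_
    calc (R.d n).comp ((e' (n + 1)).comp (e' (n + 1)))
        = ((R.d n).comp (e' (n + 1))).comp (e' (n + 1)) := rfl
      _ = ((e' n).comp (R.d n)).comp (e' (n + 1)) := by rw [hd]
      _ = (e' n).comp ((R.d n).comp (e' (n + 1))) := rfl
      _ = (e' n).comp ((e' n).comp (R.d n)) := by rw [hd]
      _ = ((e' n).comp (e' n)).comp (R.d n) := rfl
      _ = (R.d n).comp (e' (n + 1)) := by rw [ih, hd]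

/-- A graded direct summand of a module with a linear projective resolution has one. -/
theorem of_retract (R : LinearProjectiveResolution M) (h : IsPositivelyGraded 𝒜)
    (i : Hom N M) (p : Hom M N) (hpi : ∀ x, p.toLinearMap (i.toLinearMap x) = x) :
    Nonempty (LinearProjectiveResolution N) := by
  have he : (i.comp p).comp (i.comp p) = i.comp p := Hom.ext fun x => by simp [hpi]
  obtain ⟨e', h0, hd⟩ := R.exists_chainMap h (i.comp p)
  have hidem := R.chainMap_idempotent h he h0 hd
  have h0' : ∀ x, R.ε.toLinearMap ((e' 0).toLinearMap x) =
      i.toLinearMap (p.toLinearMap (R.ε.toLinearMap x)) := fun x =>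
    congrArg (fun φ : Hom _ _ => φ.toLinearMap x) h0
  have hd' : ∀ n x, (R.d n).toLinearMap ((e' (n + 1)).toLinearMap x) =
      (e' n).toLinearMap ((R.d n).toLinearMap x) := fun n x =>
    congrArg (fun φ : Hom _ _ => φ.toLinearMap x) (hd n)
  have hfix : ∀ n x, (e' n).toLinearMap ((e' n).toLinearMap x) = (e' n).toLinearMap x :=
    fun n x => congrArg (fun φ : Hom _ _ => φ.toLinearMap x) (hidem n)
  have hfix' : ∀ n (x : LinearMap.range (e' n).toLinearMap), (e' n).toLinearMap x = x := by
    rintro n ⟨_, y, rfl⟩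
    exact hfix n y
  -- The idempotent `i ∘ p` has image isomorphic to `N`. The resolution consists of the images of
  -- its lifts, with augmentation `p ∘ ε`.
  refine ⟨{
    P := fun n => homRange (e' n)
    projective := fun n => Module.Projective.of_split
      (LinearMap.range (e' n).toLinearMap).subtype (e' n).toLinearMap.rangeRestrict
      (LinearMap.ext fun x => Subtype.ext (hfix' n x))
    d := fun n =>
      { toLinearMap := (R.d n).toLinearMap.restrict (q := LinearMap.range (e' n).toLinearMap) (by
          rintro _ ⟨y, rfl⟩
          exact ⟨(R.d n).toLinearMap y, (hd' n y).symm⟩)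
        map_deg := fun hx => (R.d n).map_deg hx }
    ε :=
      { toLinearMap := p.toLinearMap ∘ₗ R.ε.toLinearMap ∘ₗ (LinearMap.range (e' 0).toLinearMap).subtype
        map_deg := fun hx => p.map_deg (R.ε.map_deg hx) }
    exact_d := fun n x => ⟨fun hx => ?_, ?_⟩
    exact_zero := fun x => ⟨fun hx => ?_, ?_⟩
    surjective := fun x => ?_
    generated := fun n => ?_ }⟩
  · obtain ⟨y, hy⟩ := (R.exact_d n _).1 (congrArg Subtype.val hx)
    -- A preimage `y` in the full resolution is replaced by `e' y`; this works because `e'` commutes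
    -- with `d` and fixes `x`.
    refine ⟨⟨(e' _).toLinearMap y, y, rfl⟩, Subtype.ext ?_⟩
    exact (hd' _ y).trans (by rw [hy]; exact hfix' _ x)
  · rintro ⟨y, rfl⟩
    exact Subtype.ext ((R.exact_d n).apply_apply_eq_zero _)
  -- As `x = e' x`, one has `ε x = i (p (ε x))`, so vanishing after `p` already gives `ε x = 0`.
  · have hx' : R.ε.toLinearMap (x : LinearMap.range (e' 0).toLinearMap).1 = 0 := by
      have h1 := h0' (x : LinearMap.range (e' 0).toLinearMap).1
      rw [hfix' 0 x] at h1
      rw [h1]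
      exact (congrArg i.toLinearMap hx).trans (map_zero _)
    obtain ⟨y, hy⟩ := (R.exact_zero _).1 hx'
    refine ⟨⟨(e' _).toLinearMap y, y, rfl⟩, Subtype.ext ?_⟩
    exact (hd' _ y).trans (by rw [hy]; exact hfix' _ x)
  · rintro ⟨y, rfl⟩
    exact (congrArg p.toLinearMap (R.exact_zero.apply_apply_eq_zero _)).trans (map_zero _)
  · obtain ⟨y, hy⟩ := R.surjective (i.toLinearMap x)
    refine ⟨⟨(e' 0).toLinearMap y, y, rfl⟩, ?_⟩
    refine (congrArg p.toLinearMap (h0' y)).trans ?_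
    rw [hpi, hy, hpi]
  · refine (AddSubgroup.eq_top_iff' _).2 ?_
    rintro ⟨_, y, rfl⟩
    have key : ∀ y : R.P n, (e' n).toLinearMap.rangeRestrict y ∈ AddSubgroup.closure
        {z : homRange (e' n) | ∃ a : A, ∃ x ∈ (homRange (e' n)).deg n,
          z = (a : Unitization k A) • x} := fun y => by
      induction y using (R.generated n).induction with
      | hp a x hx =>
        refine AddSubgroup.subset_closure ⟨a, (e' n).toLinearMap.rangeRestrict x,
          (e' n).map_deg hx, ?_⟩
        rw [map_smul]
        rfl
      | h0 => rw [map_zero]; exact zero_mem _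
      | hadd x y hx hy => rw [map_add]; exact add_mem hx hy
      | hneg x hx => rw [map_neg]; exact neg_mem hx
    exact key y

/-- Transport of a linear projective resolution along an isomorphism. -/
def ofBijective (R : LinearProjectiveResolution M) (f : Hom M N)
    (hf : Function.Bijective f.toLinearMap) : LinearProjectiveResolution N where
  P := R.P
  projective := R.projective
  d := R.d
  ε := f.comp R.ε
  exact_d := R.exact_d
  exact_zero x := by
    rw [← R.exact_zero x, Hom.comp_apply]
    exact ⟨fun hx => hf.1 (hx.trans (map_zero _).symm), fun hx => by rw [hx, map_zero]⟩
  surjective := hf.2.comp R.surjective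
  generated := R.generated

end LinearProjectiveResolution

end KoszulCategory

namespace KoszulCategory

/-! ### Projective modules `P = A P` over a non-unital algebra -/

section ProjectiveGenerated

variable {k : Type w} [Field k] {A : Type u} [NonUnitalRing A] [Module k A]
  [IsScalarTower k A A] [SMulCommClass k A A]

/-- A projective module `P` with `P = A P` embeds `A`-linearly into the direct sum of copies of `A`
indexed by `P`, as a section of the action map. -/
lemma exists_section_of_projective {P : Type*} [AddCommGroup P] [Module k P]
    [Module (Unitization k A) P] [IsScalarTower k (Unitization k A) P]
    [Module.Projective (Unitization k A) P]
    (hgen : AddSubgroup.closure {z : P | ∃ (a : A) (x : P), z = (a : Unitization k A) • x} = ⊤) :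
    ∃ s : P →ₗ[k] (P →₀ A), (∀ (a : A) (x p : P), s ((a : Unitization k A) • x) p = a * s x p) ∧
      ∀ x, (s x).sum (fun p b => (b : Unitization k A) • p) = x := by
  obtain ⟨s₀, hs₀⟩ := (Module.Projective.out : ∃ s : P →ₗ[Unitization k A] P →₀ Unitization k A,
    Function.LeftInverse (Finsupp.linearCombination (Unitization k A) id) s)
  -- Since `P = A P` and `s₀` is linear, the coordinates of `s₀ x` are sums of products with a
  -- factor in the ideal `A` of the unitization; their scalar parts vanish.
  have hfst : ∀ x p, (s₀ x p).fst = 0 := fun x => by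
    have hx : x ∈ AddSubgroup.closure
        {z : P | ∃ (a : A) (x : P), z = (a : Unitization k A) • x} := by rw [hgen]; trivial
    induction hx using AddSubgroup.closure_induction with
    | mem x hx => obtain ⟨a, y, rfl⟩ := hx; simp
    | zero => simp
    | add x y _ _ hx hy => simp [hx, hy]
    | neg x _ hx => simp [hx]
  refine ⟨Finsupp.mapRange.linearMap (Unitization.sndHom k k A) ∘ₗ s₀.restrictScalars k,
    fun a x p => ?_, fun x => ?_⟩
  · change ((s₀ ((a : Unitization k A) • x)) p).snd = a * (s₀ x p).snd
    rw [map_smul, Finsupp.smul_apply, smul_eq_mul, Unitization.snd_mul, hfst]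
    simp
  · conv_rhs => rw [← hs₀ x]
    have hinr : ∀ p, ((s₀ x p).snd : Unitization k A) = s₀ x p := fun p => by
      conv_rhs => rw [← Unitization.inl_fst_add_inr_snd_eq (s₀ x p), hfst]
      simp
    rw [Finsupp.linearCombination_apply, LinearMap.comp_apply,
      Finsupp.mapRange.linearMap_apply, Finsupp.sum_mapRange_index (by simp)]
    exact Finsupp.sum_congr fun p _ => by
      simpa using congrArg (· • p) (hinr p)

end ProjectiveGenerated

/-! ### Identities for group actions on algebras -/

namespace AlgebraAction

variable {k : Type w} [Field k] {G : Type v} [Group G] {A : Type u} [NonUnitalRing A] [Module k A]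
  (φ : AlgebraAction k G A)

lemma mul_apply (g h : G) (a : A) : φ.toHom (g * h) a = φ.toHom g (φ.toHom h a) := by
  rw [_root_.map_mul, LinearEquiv.mul_apply]

@[simp] lemma one_apply (a : A) : φ.toHom 1 a = a := by
  rw [_root_.map_one, LinearEquiv.coe_one, id]

@[simp] lemma inv_apply_self (g : G) (a : A) : φ.toHom g⁻¹ (φ.toHom g a) = a := by
  rw [← mul_apply, inv_mul_cancel, one_apply]

@[simp] lemma apply_inv_self (g : G) (a : A) : φ.toHom g (φ.toHom g⁻¹ a) = a := by
  rw [← mul_apply, mul_inv_cancel, one_apply]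

end AlgebraAction

/-! ### The grading of the skew group algebra -/

namespace SkewGroupAlgebra

variable {k : Type w} [Field k] {G : Type v} [Group G] {A : Type u} [NonUnitalRing A] [Module k A]
  (φ : AlgebraAction k G A)

/-- The map `a ↦ a ⊗ g`. -/
def tmulHom (g : G) : A →ₗ[k] SkewGroupAlgebra φ where
  toFun a := tmul φ a g
  map_add' a b := tmul_add a b g
  map_smul' c a := (smul_tmul c a g).symm

@[simp] lemma tmulHom_apply (g : G) (a : A) : tmulHom φ g a = tmul φ a g := rfl

variable {φ}

@[simp] lemma toFinsupp_tmul (a : A) (g : G) :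
    toFinsupp φ (tmul φ a g) = Finsupp.single g a := by
  simp [tmul]

lemma sum_tmul (x : SkewGroupAlgebra φ) :
    (toFinsupp φ x).sum (fun g a => tmul φ a g) = x := by
  induction x using induction with
  | h0 => simp
  | hadd x y hx hy =>
    rw [map_add, Finsupp.sum_add_index' (fun g => tmul_zero g) (fun g a b => tmul_add a b g), hx, hy]
  | ht a g => simp [tmul_zero]

lemma toFinsupp_tmul_mul (a : A) (h : G) (x : SkewGroupAlgebra φ) (g : G) :
    toFinsupp φ (tmul φ a h * x) g = a * φ.toHom h (toFinsupp φ x (h⁻¹ * g)) := by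
  induction x using induction with
  | h0 => simp
  | hadd x y hx hy => simp [mul_add, hx, hy]
  | ht b h' =>
    by_cases hgh : h * h' = g
    · subst hgh; simp [tmul_mul_tmul]
    · have : h' ≠ h⁻¹ * g := fun hh => hgh (by rw [hh, mul_inv_cancel_left])
      simp [tmul_mul_tmul, Finsupp.single_eq_of_ne' hgh, Finsupp.single_eq_of_ne' this]

variable [IsScalarTower k A A] [SMulCommClass k A A] {𝒜 : ℕ → Submodule k A}

lemma tmul_mem {n : ℕ} {a : A} (ha : a ∈ 𝒜 n) (g : G) : tmul φ a g ∈ skewGrading φ 𝒜 n :=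
  Submodule.subset_span ⟨a, ha, g, rfl⟩

lemma mem_skewGrading {n : ℕ} {x : SkewGroupAlgebra φ} :
    x ∈ skewGrading φ 𝒜 n ↔ ∀ g, toFinsupp φ x g ∈ 𝒜 n := by
  constructor
  · intro hx g
    have hle : skewGrading φ 𝒜 n ≤
        (𝒜 n).comap (Finsupp.lapply g ∘ₗ (toFinsupp φ).toLinearMap) := by
      rw [skewGrading, Submodule.span_le]
      rintro _ ⟨a, ha, h, rfl⟩
      by_cases hgh : h = g
      · subst hgh; simpa using ha
      · simp [Finsupp.single_eq_of_ne' hgh]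
    exact hle hx
  · intro hx
    rw [← sum_tmul x]
    exact sum_mem fun g _ => tmul_mem (hx g) g

/-- Directness is checked coefficientwise over `G`. Multiplicativity uses that `G` preserves
degrees, because the second factor is twisted by `g`. -/
lemma isPositivelyGraded (h : IsPositivelyGraded 𝒜)
    (hφ : ∀ g n, ∀ a ∈ 𝒜 n, φ.toHom g a ∈ 𝒜 n) : IsPositivelyGraded (skewGrading φ 𝒜) where
  isInternal := by
    refine isInternal_of_projections (N := G →₀ A) ?_ (fun j =>
      Finsupp.mapRange.linearMap (component h.isInternal j) ∘ₗ (toFinsupp φ).toLinearMap)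
      (fun i j hij x hx => ?_) (fun j x hx h0 => ?_)
    · rw [eq_top_iff]
      rintro x -
      induction x using induction with
      | h0 => exact zero_mem _
      | hadd x y hx hy => exact add_mem hx hy
      | ht a g =>
        induction a using h.induction with
        | hp n a ha => exact Submodule.mem_iSup_of_mem n (tmul_mem ha g)
        | h0 => rw [tmul_zero]; exact zero_mem _
        | hadd a b ha hb => rw [tmul_add]; exact add_mem ha hb
    · ext g
      simpa using component_of_mem_ne h.isInternal hij (mem_skewGrading.1 hx g)
    · refine (toFinsupp φ).map_eq_zero_iff.1 (Finsupp.ext fun g => ?_)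
      rw [← component_of_mem h.isInternal (mem_skewGrading.1 hx g)]
      simpa using DFunLike.congr_fun h0 g
  mul_mem {m n x y} hx hy := by
    induction hx using Submodule.span_induction with
    | zero => rw [zero_mul]; exact zero_mem _
    | add x x' _ _ hx hx' => rw [add_mul]; exact add_mem hx hx'
    | smul c x _ hx =>
      rw [smul_mul_assoc]; exact Submodule.smul_mem _ _ hx
    | mem x hx =>
      obtain ⟨a, ha, g, rfl⟩ := hx
      induction hy using Submodule.span_induction with
      | zero => rw [mul_zero]; exact zero_mem _
      | add x x' _ _ hx hx' => rw [mul_add]; exact add_mem hx hx'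
      | smul c x _ hx => rw [mul_smul_comm]; exact Submodule.smul_mem _ _ hx
      | mem y hy =>
        obtain ⟨b, hb, g', rfl⟩ := hy
        rw [tmul_mul_tmul]
        exact tmul_mem (h.mul_mem ha (hφ g n b hb)) _

end SkewGroupAlgebra

/-! ### The degree zero part -/

section DegreeZero

variable {k : Type w} [Field k] {A : Type u} [NonUnitalRing A] [Module k A]
  [IsScalarTower k A A] [SMulCommClass k A A] {𝒜 : ℕ → Submodule k A}

lemma degreeZero_smul (h : IsPositivelyGraded 𝒜) (a : A) (x : h.degreeZero) :
    ((a : Unitization k A) • x : h.degreeZero) = h.actZero a x := by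
  change (Unitization.lift h.actZero) (a : Unitization k A) x = _
  simp

lemma degreeZero_smul_coe (h : IsPositivelyGraded 𝒜) (a : A) (x : h.degreeZero) :
    (((a : Unitization k A) • x : h.degreeZero) : 𝒜 0).1 = (h.projZero a : A) * (x : 𝒜 0).1 := by
  rw [degreeZero_smul]
  rfl

lemma mem_degreeZero_deg (h : IsPositivelyGraded 𝒜) (x : h.degreeZero) (j : ℤ) :
    x ∈ h.degreeZero.deg j ↔ j = 0 ∨ x = 0 := by
  have key : ∀ y : 𝒜 0, y ∈ (if j = 0 then (⊤ : Submodule k (𝒜 0)) else ⊥) ↔ j = 0 ∨ y = 0 :=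
    fun y => by split_ifs with hj <;> simp [hj]
  exact key x

variable {G : Type v} [Group G] {φ : AlgebraAction k G A}

open SkewGroupAlgebra

lemma projZero_tmul (h : IsPositivelyGraded 𝒜) (hs : IsPositivelyGraded (skewGrading φ 𝒜))
    (a : A) (g : G) : (hs.projZero (tmul φ a g) : SkewGroupAlgebra φ) =
      tmul φ (h.projZero a) g := by
  induction a using h.induction with
  | hp n a ha =>
    rcases eq_or_ne n 0 with rfl | hn
    · rw [h.projZero_of_mem_zero ha, hs.projZero_of_mem_zero (tmul_mem ha g)]
    · rw [h.projZero_of_mem_ne hn ha, hs.projZero_of_mem_ne hn (tmul_mem ha g)]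
      simp [tmul_zero]
  | h0 => simp [tmul_zero]
  | hadd a b ha hb => simp [tmul_add, ha, hb]

lemma projZero_apply (h : IsPositivelyGraded 𝒜)
    (hφ : ∀ g n, ∀ a ∈ 𝒜 n, φ.toHom g a ∈ 𝒜 n) (a : A) (g : G) :
    (h.projZero (φ.toHom g a) : A) = φ.toHom g (h.projZero a) := by
  induction a using h.induction with
  | hp n a ha =>
    rcases eq_or_ne n 0 with rfl | hn
    · rw [h.projZero_of_mem_zero ha, h.projZero_of_mem_zero (hφ g _ a ha)]
    · rw [h.projZero_of_mem_ne hn ha, h.projZero_of_mem_ne hn (hφ g _ a ha)]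
      simp
  | h0 => simp
  | hadd a b ha hb => simp [ha, hb]

end DegreeZero

/-! ### Induction -/

section Induction

variable {k : Type w} [Field k] {G : Type v} [Group G] {A : Type u} [NonUnitalRing A] [Module k A]
  [IsScalarTower k A A] [SMulCommClass k A A] (φ : AlgebraAction k G A)
  (P : Type*) [AddCommGroup P] [Module k P] [Module (Unitization k A) P]
  [IsScalarTower k (Unitization k A) P]

/-- The action of `a ⊗ h` on the induced module, realized as the space of functions `G → P`. -/
def inductionActionAux (h : G) : A →ₗ[k] Module.End k (G → P) where
  toFun a :=
    -- The function `u` stands for `∑ g ⊗ u g`. Moving `a` past the group element in `a h (g' ⊗ x)`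
    -- gives `h g' ⊗ (h g')⁻¹(a) x`; here `g = h g'`.
    { toFun := fun u g => (φ.toHom g⁻¹ a : Unitization k A) • u (h⁻¹ * g)
      map_add' := fun u v => by ext; simp
      map_smul' := fun c u => by ext; simp [smul_algebra_smul_comm] }
  map_add' a b := by ext; simp [add_smul]
  map_smul' c a := by ext; simp

/-- The action of `A # G` on the induced module, as a linear map. -/
def inductionActionₗ : SkewGroupAlgebra φ →ₗ[k] Module.End k (G → P) :=
  Finsupp.lsum k (inductionActionAux φ P) ∘ₗ (SkewGroupAlgebra.toFinsupp φ).toLinearMap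

lemma inductionActionₗ_tmul (a : A) (h : G) (u : G → P) (g : G) :
    inductionActionₗ φ P (SkewGroupAlgebra.tmul φ a h) u g =
      (φ.toHom g⁻¹ a : Unitization k A) • u (h⁻¹ * g) := by
  rw [inductionActionₗ, LinearMap.comp_apply, LinearEquiv.coe_coe,
    SkewGroupAlgebra.toFinsupp_tmul, Finsupp.lsum_single]
  rfl

/-- The action of `A # G` on the induced module, realized as the space of functions `G → P`. -/
def inductionAction : SkewGroupAlgebra φ →ₙₐ[k] Module.End k (G → P) :=
  { inductionActionₗ φ P with
    map_zero' := map_zero _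
    map_mul' := fun x y => by
      change inductionActionₗ φ P (x * y) = inductionActionₗ φ P x * inductionActionₗ φ P y
      induction x using SkewGroupAlgebra.induction with
      | h0 => simp
      | hadd x x' hx hx' => rw [add_mul, map_add, map_add, add_mul, hx, hx']
      | ht a g =>
        induction y using SkewGroupAlgebra.induction with
        | h0 => simp
        | hadd y y' hy hy' => rw [mul_add, map_add, map_add, mul_add, hy, hy']
        | ht b h =>
          refine LinearMap.ext fun u => funext fun g' => ?_
          rw [SkewGroupAlgebra.tmul_mul_tmul, Module.End.mul_apply, inductionActionₗ_tmul,
            inductionActionₗ_tmul, inductionActionₗ_tmul, φ.map_mul, Unitization.inr_mul, mul_smul,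
            ← AlgebraAction.mul_apply, mul_inv_rev, mul_inv_rev, inv_inv, mul_assoc] }

lemma inductionAction_tmul (a : A) (h : G) (u : G → P) (g : G) :
    inductionAction φ P (SkewGroupAlgebra.tmul φ a h) u g =
      (φ.toHom g⁻¹ a : Unitization k A) • u (h⁻¹ * g) :=
  inductionActionₗ_tmul φ P a h u g

end Induction

/-! ### Induction of graded modules and of linear resolutions -/

section GradedInduction

variable {k : Type w} [Field k] {G : Type w} [Group G] [Fintype G] {A : Type (max u w)}
  [NonUnitalRing A] [Module k A] [IsScalarTower k A A] [SMulCommClass k A A]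
  {φ : AlgebraAction k G A} {𝒜 : ℕ → Submodule k A}

open GradedLeftModule SkewGroupAlgebra

open Classical in
/-- The graded `A # G`-module induced from a graded `A`-module. -/
def GradedLeftModule.induced (hφ : ∀ g n, ∀ a ∈ 𝒜 n, φ.toHom g a ∈ 𝒜 n)
    (M : GradedLeftModule.{max u w} 𝒜) : GradedLeftModule.{max u w} (skewGrading φ 𝒜) :=
  letI := moduleOfAction (inductionAction φ M)
  { carrier := G → M
    isScalarTower := isScalarTower_moduleOfAction (inductionAction φ M)
    deg := fun j => Submodule.pi Set.univ fun _ => M.deg j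
    isInternal := by
      refine isInternal_of_projections (N := G → M) ?_
        (fun j => LinearMap.pi fun g => component M.isInternal j ∘ₗ LinearMap.proj g)
        (fun i j hij x hx => funext fun g => component_of_mem_ne M.isInternal hij (hx g trivial))
        (fun j x hx h0 => funext fun g => ?_)
      · rw [eq_top_iff]
        rintro u -
        rw [← Finset.univ_sum_single u]
        refine sum_mem fun g _ => ?_
        induction u g using internal_induction M.isInternal with
        | hp j x hx =>
          refine Submodule.mem_iSup_of_mem j fun g' _ => ?_
          by_cases hg : g' = g
          · subst hg; simpa using hx
          · simp [hg]
        | hadd x y hx hy => rw [Pi.single_add]; exact add_mem hx hy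
      · rw [← component_of_mem M.isInternal (hx g trivial)]
        exact congrFun h0 g
    smul_mem := fun {m j x u} hx hu g _ => by
      rw [moduleOfAction_smul]
      induction hx using Submodule.span_induction with
      | zero => simp
      | add x x' _ _ hx hx' => rw [map_add]; exact add_mem hx hx'
      | smul c x _ hx => rw [map_smul]; exact Submodule.smul_mem _ _ hx
      | mem x hx =>
        obtain ⟨a, ha, h, rfl⟩ := hx
        rw [inductionAction_tmul]
        exact M.smul_mem (hφ _ _ _ ha) (hu _ trivial) }

variable (hφ : ∀ g n, ∀ a ∈ 𝒜 n, φ.toHom g a ∈ 𝒜 n)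

lemma induced_smul (M : GradedLeftModule.{max u w} 𝒜) (a : A) (h : G) (u : M.induced hφ) (g : G) :
    ((tmul φ a h : Unitization k (SkewGroupAlgebra φ)) • u : M.induced hφ) g =
      (φ.toHom g⁻¹ a : Unitization k A) • (u : G → M) (h⁻¹ * g) :=
  (congrFun (moduleOfAction_smul (inductionAction φ M) (tmul φ a h) u) g).trans
    (inductionAction_tmul φ M a h u g)

open Classical in
/-- The element `g ⊗ x` of the induced module. -/
def inducedSingle (M : GradedLeftModule.{max u w} 𝒜) (g : G) : M →ₗ[k] M.induced hφ :=
  LinearMap.single k (fun _ : G => (M : Type (max u w))) g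

lemma inducedSingle_same (M : GradedLeftModule.{max u w} 𝒜) (g : G) (x : M) :
    (inducedSingle hφ M g x : G → M) g = x := by
  classical exact Pi.single_eq_same (M := fun _ : G => (M : Type (max u w))) g x

lemma inducedSingle_of_ne (M : GradedLeftModule.{max u w} 𝒜) {g g' : G} (h : g' ≠ g) (x : M) :
    (inducedSingle hφ M g x : G → M) g' = 0 := by
  classical exact Pi.single_eq_of_ne (M := fun _ : G => (M : Type (max u w))) h x

lemma sum_inducedSingle (M : GradedLeftModule.{max u w} 𝒜) (u : M.induced hφ) :
    ∑ g, inducedSingle hφ M g ((u : G → M) g) = u :=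
  by classical exact Finset.univ_sum_single (u : G → M)

/-- In `A # G` one has `g a = g(a) g`. Without a unit `g` itself need not belong to `A # G`, so only
the elements `g ⊗ a x` are reached from `1 ⊗ x` in this way; when `M = A M` they suffice. -/
lemma tmul_smul_inducedSingle (M : GradedLeftModule.{max u w} 𝒜) (a : A) (g : G) (x : M) :
    (tmul φ (φ.toHom g a) g : Unitization k (SkewGroupAlgebra φ)) • inducedSingle hφ M 1 x =
      inducedSingle hφ M g ((a : Unitization k A) • x) := by
  refine funext (α := G) (β := fun _ => M) fun g' => ?_
  rw [induced_smul]
  by_cases hg : g' = g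
  · subst hg
    rw [inv_mul_cancel, inducedSingle_same, inducedSingle_same, AlgebraAction.inv_apply_self]
  · rw [inducedSingle_of_ne _ _ hg, inducedSingle_of_ne, smul_zero]
    rwa [Ne, inv_mul_eq_one, eq_comm]

lemma inducedSingle_mem (M : GradedLeftModule.{max u w} 𝒜) (g : G) {j : ℤ} {x : M}
    (hx : x ∈ M.deg j) : inducedSingle hφ M g x ∈ (M.induced hφ).deg j := fun g' _ => by
  by_cases hg : g' = g
  · subst hg
    exact (inducedSingle_same hφ M g' x).symm ▸ hx
  · have := inducedSingle_of_ne hφ M hg x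
    exact this.symm ▸ zero_mem _

lemma isGeneratedInDegree_induced {M : GradedLeftModule.{max u w} 𝒜} {i : ℤ}
    (hM : M.IsGeneratedInDegree i) : (M.induced hφ).IsGeneratedInDegree i := by
  refine (AddSubgroup.eq_top_iff' _).2 fun u => ?_
  rw [← sum_inducedSingle hφ M u]
  refine sum_mem fun g _ => ?_
  induction (u : G → M) g using hM.induction with
  | hp a x hx =>
    exact AddSubgroup.subset_closure ⟨tmul φ (φ.toHom g a) g, inducedSingle hφ M 1 x,
      inducedSingle_mem hφ M 1 hx, (tmul_smul_inducedSingle hφ M a g x).symm⟩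
  | h0 => rw [map_zero]; exact zero_mem _
  | hadd x y hx hy => rw [map_add]; exact add_mem hx hy
  | hneg x hx => rw [map_neg]; exact neg_mem hx

lemma GradedLeftModule.IsGeneratedInDegree.closure_smul_eq_top {k : Type w} [Field k] {A : Type u}
    [NonUnitalRing A] [Module k A] [IsScalarTower k A A] [SMulCommClass k A A]
    {𝒜 : ℕ → Submodule k A} {M : GradedLeftModule 𝒜} {i : ℤ}
    (hM : M.IsGeneratedInDegree i) :
    AddSubgroup.closure {z : M | ∃ (a : A) (x : M), z = (a : Unitization k A) • x} = ⊤ :=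
  top_unique <| hM.symm.trans_le <| AddSubgroup.closure_mono fun _ ⟨a, x, _, h⟩ => ⟨a, x, h⟩

/-- A section of the action map `⊕ A → M` is induced up, using `g ⊗ a ↦ g(a) ⊗ g` to send copies of
`A` into `A # G`. The result splits the map from the free module that sends the basis vector of `p`
to `1 ⊗ p`. -/
lemma projective_induced {M : GradedLeftModule.{max u w} 𝒜}
    [Module.Projective (Unitization k A) M] {i : ℤ} (hM : M.IsGeneratedInDegree i) :
    Module.Projective (Unitization k (SkewGroupAlgebra φ)) (M.induced hφ) := by
  obtain ⟨s, hs, hsum⟩ := exists_section_of_projective hM.closure_smul_eq_top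
  let τ : G → A →ₗ[k] Unitization k (SkewGroupAlgebra φ) := fun g =>
    Unitization.inrHom k k (SkewGroupAlgebra φ) ∘ₗ tmulHom φ g ∘ₗ (φ.toHom g).toLinearMap
  have hτ : ∀ g a, τ g a = (tmul φ (φ.toHom g a) g : Unitization k (SkewGroupAlgebra φ)) :=
    fun _ _ => rfl
  let S : M.induced hφ →ₗ[k] (M →₀ Unitization k (SkewGroupAlgebra φ)) :=
    ∑ g, Finsupp.mapRange.linearMap (τ g) ∘ₗ s ∘ₗ (LinearMap.proj g : (G → M) →ₗ[k] M)
  have hS : ∀ u : M.induced hφ, S u = ∑ g, Finsupp.mapRange.linearMap (τ g) (s ((u : G → M) g)) :=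
    fun u => by
      simp only [S, LinearMap.sum_apply]
      rfl
  refine Module.Projective.of_split (linearOfCommute S fun x u => ?_)
    (Finsupp.linearCombination _ (inducedSingle hφ M 1)) (LinearMap.ext fun u => ?_)
  · induction x using SkewGroupAlgebra.induction with
    | h0 => simp
    | hadd x y hx hy => rw [Unitization.inr_add, add_smul, add_smul, map_add, hx, hy]
    | ht a h =>
      rw [hS, hS]
      refine Finsupp.ext fun p => ?_
      simp only [Finsupp.finsetSum_apply, Finsupp.smul_apply, Finsupp.mapRange.linearMap_apply,
        Finsupp.mapRange_apply, smul_eq_mul, Finset.mul_sum]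
      -- Multiplication by `a ⊗ h` moves the summand at `g` to the one at `h g`.
      rw [← Equiv.sum_comp (Equiv.mulLeft h)]
      refine Finset.sum_congr rfl fun g _ => ?_
      rw [Equiv.coe_mulLeft, induced_smul, hs, hτ, hτ, ← Unitization.inr_mul, tmul_mul_tmul,
        φ.map_mul, AlgebraAction.apply_inv_self, inv_mul_cancel_left, AlgebraAction.mul_apply]
  · rw [LinearMap.comp_apply, linearOfCommute_apply, hS, map_sum, LinearMap.id_apply]
    conv_rhs => rw [← sum_inducedSingle hφ M u]
    refine Finset.sum_congr rfl fun g _ => ?_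
    rw [Finsupp.linearCombination_apply, Finsupp.mapRange.linearMap_apply,
      Finsupp.sum_mapRange_index (by simp)]
    conv_rhs => rw [← hsum ((u : G → M) g), map_finsuppSum]
    exact Finsupp.sum_congr fun p _ => by rw [hτ, tmul_smul_inducedSingle]

/-- The homomorphism induced from a homomorphism of graded `A`-modules. -/
def GradedLeftModule.Hom.induced {M N : GradedLeftModule.{max u w} 𝒜} (f : Hom M N) :
    Hom (M.induced hφ) (N.induced hφ) where
  toLinearMap := linearOfCommute
    (M := M.induced hφ) (N := N.induced hφ)
    { toFun := fun (u : G → M) => fun g => f.toLinearMap (u g)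
      map_add' := fun u v => funext fun g => map_add f.toLinearMap _ _
      map_smul' := fun c u => funext fun g => map_smul_base f.toLinearMap _ _ }
    (fun x u => by
      induction x using SkewGroupAlgebra.induction with
      | h0 => simp
      | hadd x y hx hy => rw [Unitization.inr_add, add_smul, add_smul, map_add, hx, hy]
      | ht a h =>
        funext g
        rw [induced_smul]
        change f.toLinearMap _ = _
        rw [induced_smul, map_smul]
        rfl)
  map_deg hu := fun g _ => f.map_deg (hu g trivial)

lemma exact_induced {M N K : GradedLeftModule.{max u w} 𝒜} {f : Hom M N} {f' : Hom N K}
    (hf : Function.Exact f.toLinearMap f'.toLinearMap) :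
    Function.Exact (f.induced hφ).toLinearMap (f'.induced hφ).toLinearMap := fun u => by
  constructor
  · intro hu
    have : ∀ g, ∃ y, f.toLinearMap y = (u : G → N) g := fun g => (hf _).1 (congrFun hu g)
    choose y hy using this
    exact ⟨y, funext hy⟩
  · rintro ⟨y, rfl⟩
    exact funext fun g => hf.apply_apply_eq_zero _

lemma surjective_induced {M N : GradedLeftModule.{max u w} 𝒜} {f : Hom M N}
    (hf : Function.Surjective f.toLinearMap) :
    Function.Surjective (f.induced hφ).toLinearMap := fun u => by
  choose y hy using hf
  exact ⟨fun g => y ((u : G → N) g), funext fun g => hy _⟩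

variable (φ 𝒜) in
/-- The map from the module induced from `A₀` to the degree zero part of `A # G`, with
`g ⊗ a ↦ g(a) ⊗ g`, as a linear map. -/
def inducedDegreeZeroₗ (hφ : ∀ g n, ∀ a ∈ 𝒜 n, φ.toHom g a ∈ 𝒜 n) :
    (G → 𝒜 0) →ₗ[k] skewGrading φ 𝒜 0 :=
  LinearMap.codRestrict (skewGrading φ 𝒜 0)
    (∑ g, tmulHom φ g ∘ₗ (φ.toHom g).toLinearMap ∘ₗ (𝒜 0).subtype ∘ₗ LinearMap.proj g)
    (fun u => by
      rw [LinearMap.sum_apply]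
      exact sum_mem fun g _ => tmul_mem (hφ g 0 _ (u g).2) g)

lemma toFinsupp_inducedDegreeZeroₗ (u : G → 𝒜 0) (g : G) :
    toFinsupp φ (inducedDegreeZeroₗ φ 𝒜 hφ u).1 g = φ.toHom g (u g) := by
  rw [inducedDegreeZeroₗ, LinearMap.codRestrict_apply,
    LinearMap.sum_apply, map_sum, Finsupp.finsetSum_apply, Finset.sum_eq_single g]
  · simp
  · intro g' _ hg
    simp [Finsupp.single_eq_of_ne' hg]
  · simp

/-- The map from the module induced from `A₀` to the degree zero part of `A # G`, with
`g ⊗ a ↦ g(a) ⊗ g`. -/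
def inducedDegreeZeroHom (h : IsPositivelyGraded 𝒜)
    (hs : IsPositivelyGraded (skewGrading φ 𝒜)) :
    Hom ((h.degreeZero).induced hφ) hs.degreeZero where
  toLinearMap := linearOfCommute (M := (h.degreeZero).induced hφ) (N := hs.degreeZero)
    (show (h.degreeZero).induced hφ →ₗ[k] hs.degreeZero from inducedDegreeZeroₗ φ 𝒜 hφ)
    (fun x u => by
      induction x using SkewGroupAlgebra.induction with
      | h0 =>
        rw [Unitization.inr_zero, zero_smul, zero_smul]
        exact map_zero (inducedDegreeZeroₗ φ 𝒜 hφ)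
      | hadd x y hx hy =>
        rw [Unitization.inr_add, add_smul, add_smul, ← hx, ← hy]
        exact map_add (inducedDegreeZeroₗ φ 𝒜 hφ) _ _
      | ht a h' =>
        refine Subtype.ext ((toFinsupp φ).injective (Finsupp.ext fun g => ?_))
        rw [degreeZero_smul_coe, projZero_tmul h hs]
        refine (toFinsupp_inducedDegreeZeroₗ hφ _ g).trans ?_
        rw [toFinsupp_tmul_mul, induced_smul, degreeZero_smul_coe, projZero_apply h hφ, φ.map_mul,
          AlgebraAction.apply_inv_self]
        congr 1
        refine Eq.trans ?_ (congrArg _ (toFinsupp_inducedDegreeZeroₗ hφ _ _).symm)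
        rw [← AlgebraAction.mul_apply, mul_inv_cancel_left])
  map_deg {j u} hu := by
    rw [mem_degreeZero_deg]
    by_cases hj : j = 0
    · exact Or.inl hj
    · have : u = 0 := funext fun g =>
        ((mem_degreeZero_deg h _ j).1 (hu g trivial)).resolve_left hj
      rw [this]
      exact Or.inr (map_zero _)

/-- The inverse untwists each coefficient: the value at `g` is `g⁻¹` applied to the coefficient at
`g`. -/
lemma bijective_inducedDegreeZeroHom (h : IsPositivelyGraded 𝒜)
    (hs : IsPositivelyGraded (skewGrading φ 𝒜)) :
    Function.Bijective (inducedDegreeZeroHom hφ h hs).toLinearMap := by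
  constructor
  · intro u v huv
    refine funext (α := G) (β := fun _ => 𝒜 0) fun g =>
      Subtype.ext ((φ.toHom g).injective ?_)
    have := congrArg (fun x : skewGrading φ 𝒜 0 => toFinsupp φ x.1 g) huv
    exact (toFinsupp_inducedDegreeZeroₗ hφ u g).symm.trans
      (this.trans (toFinsupp_inducedDegreeZeroₗ hφ v g))
  · intro x
    refine ⟨fun g => (⟨φ.toHom g⁻¹ (toFinsupp φ (x : skewGrading φ 𝒜 0).1 g),
      hφ _ _ _ (mem_skewGrading.1 (x : skewGrading φ 𝒜 0).2 g)⟩ : 𝒜 0), Subtype.ext ?_⟩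
    refine (toFinsupp φ).injective (Finsupp.ext fun g => ?_)
    refine (toFinsupp_inducedDegreeZeroₗ hφ _ g).trans ?_
    exact AlgebraAction.apply_inv_self _ _ _

/-- The linear projective resolution of `(A # G)₀` induced from one of `A₀`. -/
def LinearProjectiveResolution.induced (h : IsPositivelyGraded 𝒜)
    (hs : IsPositivelyGraded (skewGrading φ 𝒜)) (R : LinearProjectiveResolution h.degreeZero) :
    LinearProjectiveResolution hs.degreeZero :=
  LinearProjectiveResolution.ofBijective
    { P := fun n => (R.P n).induced hφ
      projective := fun n =>
        haveI := R.projective n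
        projective_induced hφ (R.generated n)
      d := fun n => (R.d n).induced hφ
      ε := R.ε.induced hφ
      exact_d := fun n => exact_induced hφ (R.exact_d n)
      exact_zero := exact_induced hφ R.exact_zero
      surjective := surjective_induced hφ R.surjective
      generated := fun n => isGeneratedInDegree_induced hφ (R.generated n) }
    (inducedDegreeZeroHom hφ h hs) (bijective_inducedDegreeZeroHom hφ h hs)

end GradedInduction

end KoszulCategory

namespace KoszulCategory

/-- A family of elements `u y` of degree zero with `a = ∑ y, σ a y * u y`, where `σ` is left
linear.  This takes the place of a unit of `A`. -/
structure IsRightUnitSystem {k : Type w} [Field k] {A : Type u} [NonUnitalRing A] [Module k A]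
    (𝒜 : ℕ → Submodule k A) {X : Type*} (σ : A →ₗ[k] X →₀ A) (u : X → A) : Prop where
  map_mul : ∀ a b y, σ (a * b) y = a * σ b y
  sum_mul : ∀ a, (σ a).sum (fun y b => b * u y) = a
  mem : ∀ y, u y ∈ 𝒜 0

/-! ### Restriction -/

section Restriction

open SkewGroupAlgebra

variable {k : Type w} [Field k] {G : Type v} [Group G] {A : Type u} [NonUnitalRing A] [Module k A]
  [IsScalarTower k A A] [SMulCommClass k A A] (φ : AlgebraAction k G A)
  (M : Type*) [AddCommGroup M] [Module k M] [Module (Unitization k (SkewGroupAlgebra φ)) M]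
  [IsScalarTower k (Unitization k (SkewGroupAlgebra φ)) M]

/-- The action of `A` on an `A # G`-module. -/
def restrictionAction : A →ₙₐ[k] Module.End k M where
  toFun a :=
    { toFun := fun x => (tmul φ a 1 : Unitization k (SkewGroupAlgebra φ)) • x
      map_add' := fun x y => smul_add _ _ _
      map_smul' := fun c x => by simp [smul_algebra_smul_comm] }
  map_smul' c a := by ext; simp [← smul_tmul]
  map_zero' := by ext; simp [tmul_zero]
  map_add' a b := by ext; simp [tmul_add, add_smul]
  map_mul' a b := by
    ext x
    simp [← mul_smul, ← Unitization.inr_mul, tmul_mul_tmul]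

lemma restrictionAction_apply (a : A) (x : M) :
    restrictionAction φ M a x = (tmul φ a 1 : Unitization k (SkewGroupAlgebra φ)) • x := rfl

end Restriction

/-! ### Restriction of graded modules and of linear resolutions -/

section GradedRestriction

open SkewGroupAlgebra GradedLeftModule

variable {k : Type w} [Field k] {G : Type w} [Group G] {A : Type (max u w)}
  [NonUnitalRing A] [Module k A] [IsScalarTower k A A] [SMulCommClass k A A]
  {φ : AlgebraAction k G A} {𝒜 : ℕ → Submodule k A}

/-- The restriction of a graded `A # G`-module to `A`. -/
def GradedLeftModule.restrict (M : GradedLeftModule.{max u w} (skewGrading φ 𝒜)) :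
    GradedLeftModule.{max u w} 𝒜 :=
  letI := moduleOfAction (restrictionAction φ M)
  { carrier := M
    isScalarTower := isScalarTower_moduleOfAction (restrictionAction φ M)
    deg := M.deg
    isInternal := M.isInternal
    smul_mem := fun {m j a x} ha hx => by
      rw [moduleOfAction_smul]
      exact M.smul_mem (tmul_mem ha 1) hx }

lemma restrict_smul (M : GradedLeftModule.{max u w} (skewGrading φ 𝒜)) (a : A) (x : M.restrict) :
    ((a : Unitization k A) • x : M.restrict) = restrictionAction φ M a x :=
  moduleOfAction_smul (restrictionAction φ M) a x

/-- A homomorphism of graded `A # G`-modules as a homomorphism of graded `A`-modules. -/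
def GradedLeftModule.Hom.restrict {M N : GradedLeftModule.{max u w} (skewGrading φ 𝒜)}
    (f : Hom M N) : Hom M.restrict N.restrict where
  toLinearMap := linearOfCommute (M := M.restrict) (N := N.restrict)
    (show M.restrict →ₗ[k] N.restrict from f.toLinearMap.restrictScalars k) (fun a x => by
      rw [restrict_smul, restrict_smul]
      exact map_smul f.toLinearMap (tmul φ a 1 : Unitization k (SkewGroupAlgebra φ)) _)
  map_deg hx := f.map_deg hx

variable {X : Type*} {σ : A →ₗ[k] X →₀ A} {e : X → A}

/-- With `a = ∑ b_y e_y` one has `a ⊗ g = ∑ (b_y ⊗ 1)(e_y ⊗ g)`. The factors `e_y ⊗ g` have degree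
zero, hence preserve `M_i`, so the left factors from `A` alone generate. -/
lemma IsRightUnitSystem.isGeneratedInDegree_restrict (hσ : IsRightUnitSystem 𝒜 σ e)
    {M : GradedLeftModule.{max u w} (skewGrading φ 𝒜)} {i : ℤ} (hM : M.IsGeneratedInDegree i) :
    M.restrict.IsGeneratedInDegree i := by
  refine (AddSubgroup.eq_top_iff' _).2 fun x => ?_
  induction (x : M) using hM.induction with
  | hp a x hx =>
    induction a using SkewGroupAlgebra.induction with
    | h0 => rw [Unitization.inr_zero, zero_smul]; exact zero_mem _
    | hadd a b ha hb => rw [Unitization.inr_add, add_smul]; exact add_mem ha hb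
    | ht a g =>
      have hsum : (tmul φ a g : Unitization k (SkewGroupAlgebra φ)) • x = (σ a).sum fun y b =>
          (tmul φ b 1 : Unitization k (SkewGroupAlgebra φ)) •
            ((tmul φ (e y) g : Unitization k (SkewGroupAlgebra φ)) • x) := by
        let L : A →ₗ[k] M := (LinearMap.toSpanSingleton (Unitization k (SkewGroupAlgebra φ)) M
          x).restrictScalars k ∘ₗ Unitization.inrHom k k _ ∘ₗ tmulHom φ g
        change L a = _
        conv_lhs => rw [← hσ.sum_mul a, map_finsuppSum]
        refine Finset.sum_congr rfl fun y _ => ?_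
        change L (σ a y * e y) = (tmul φ (σ a y) 1 : Unitization k (SkewGroupAlgebra φ)) •
          ((tmul φ (e y) g : Unitization k (SkewGroupAlgebra φ)) • x)
        rw [← mul_smul, ← Unitization.inr_mul, tmul_mul_tmul, one_mul, AlgebraAction.one_apply]
        rfl
      rw [hsum]
      refine sum_mem fun y _ => AddSubgroup.subset_closure ⟨σ a y, _, ?_, (restrict_smul M _ _).symm⟩
      have hmem := M.smul_mem (tmul_mem (hσ.mem y) g) hx
      rw [Nat.cast_zero, zero_add] at hmem
      exact hmem
  | h0 => exact zero_mem _
  | hadd x y hx hy => exact add_mem hx hy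
  | hneg x hx => exact neg_mem hx

/-- `M` is a summand of a sum of copies of `A # G`, which as a left `A`-module is a sum of copies of
`A`. In turn `σ` makes `A` a summand of a free module over its unitization. The section `S` and the
retraction `T` below compose these splittings. -/
lemma IsRightUnitSystem.projective_restrict (hσ : IsRightUnitSystem 𝒜 σ e)
    {M : GradedLeftModule.{max u w} (skewGrading φ 𝒜)}
    [Module.Projective (Unitization k (SkewGroupAlgebra φ)) M] {i : ℤ}
    (hM : M.IsGeneratedInDegree i) :
    Module.Projective (Unitization k A) M.restrict := by
  obtain ⟨s, hs, hsum⟩ := exists_section_of_projective hM.closure_smul_eq_top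
  -- The coordinate at `((q, g), y)` is the `y`-part, under `σ`, of the coefficient at `g` of the
  -- `q`-th entry.
  let S' : (M →₀ SkewGroupAlgebra φ) →ₗ[k] ((M × G) × X →₀ Unitization k A) :=
    Finsupp.mapRange.linearMap (Unitization.inrHom k k A) ∘ₗ
    (Finsupp.curryLinearEquiv k).symm.toLinearMap ∘ₗ (Finsupp.curryLinearEquiv k).symm.toLinearMap ∘ₗ
    Finsupp.mapRange.linearMap (Finsupp.mapRange.linearMap σ ∘ₗ (toFinsupp φ).toLinearMap)
  have hS : ∀ f q g y, S' f ((q, g), y) = (σ (toFinsupp φ (f q) g) y : Unitization k A) :=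
    fun _ _ _ _ => rfl
  let S : M.restrict →ₗ[k] ((M × G) × X →₀ Unitization k A) :=
    S' ∘ₗ (show M.restrict →ₗ[k] (M →₀ SkewGroupAlgebra φ) from s)
  -- The basis vector of `((q, g), y)` goes to `(e y ⊗ g) q`, so that `∑ b_y e_y = a` reassembles
  -- `(a ⊗ g) q`.
  let T : ((M × G) × X →₀ Unitization k A) →ₗ[Unitization k A] M.restrict :=
    Finsupp.linearCombination _ (fun z =>
      (show M.restrict from (tmul φ (e z.2) z.1.2 : Unitization k (SkewGroupAlgebra φ)) • z.1.1))
  have hT : ∀ f, T (S' f) = f.sum (fun p b => (b : Unitization k (SkewGroupAlgebra φ)) • p) := by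
    intro f
    have hsingle : ∀ q g (c : X →₀ A), T (Finsupp.mapRange.linearMap (Unitization.inrHom k k A)
        ((Finsupp.curryLinearEquiv k).symm ((Finsupp.curryLinearEquiv k).symm
          (Finsupp.single q (Finsupp.single g c))))) =
        (tmul φ (c.sum fun y b => b * e y) g : Unitization k (SkewGroupAlgebra φ)) • q := by
      intro q g c
      induction c using Finsupp.induction_linear with
      | zero =>
        rw [Finsupp.single_zero, Finsupp.single_zero, map_zero, map_zero, map_zero, map_zero,
          Finsupp.sum_zero_index, tmul_zero, Unitization.inr_zero, zero_smul]
        rfl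
      | add c d hc hd =>
        rw [Finsupp.single_add, Finsupp.single_add, map_add, map_add, map_add, map_add, hc, hd,
          Finsupp.sum_add_index' (by simp) (by simp [add_mul]), tmul_add, Unitization.inr_add,
          add_smul]
        rfl
      | single y a =>
        have : ((Finsupp.curryLinearEquiv k).symm ((Finsupp.curryLinearEquiv k).symm
            (Finsupp.single q (Finsupp.single g (Finsupp.single y a))))) =
            Finsupp.single ((q, g), y) a := by
          simp [Finsupp.curryLinearEquiv]
        rw [this, Finsupp.mapRange.linearMap_apply, Finsupp.mapRange_single,
          Finsupp.linearCombination_single, Unitization.inrHom_apply, restrict_smul,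
          restrictionAction_apply]
        rw [← mul_smul, ← Unitization.inr_mul, tmul_mul_tmul, one_mul, AlgebraAction.one_apply,
          Finsupp.sum_single_index (by simp)]
    induction f using Finsupp.induction_linear with
    | zero => rw [map_zero, map_zero]; rfl
    | add f f' hf hf' =>
      rw [map_add, map_add, hf, hf', Finsupp.sum_add_index' (by simp) (by simp [add_smul])]
      rfl
    | single q x =>
      rw [Finsupp.sum_single_index (by simp)]
      induction x using SkewGroupAlgebra.induction with
      | h0 => rw [Finsupp.single_zero, map_zero, map_zero, Unitization.inr_zero, zero_smul]; rfl
      | hadd x y hx hy =>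
        rw [Finsupp.single_add, map_add, map_add, hx, hy, Unitization.inr_add, add_smul]
        rfl
      | ht b g =>
        rw [← hσ.sum_mul b, ← hsingle, hσ.sum_mul]
        simp only [S', LinearMap.comp_apply, Finsupp.mapRange.linearMap_apply,
          Finsupp.mapRange_single, LinearEquiv.coe_coe, toFinsupp_tmul]
  refine Module.Projective.of_split (linearOfCommute S fun a x => ?_) T
    (LinearMap.ext fun x => ?_)
  · refine Finsupp.ext fun ⟨⟨q, g⟩, y⟩ => ?_
    rw [Finsupp.smul_apply]
    change S' (s _) _ = _ • S' (s _) _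
    rw [hS, hS, restrict_smul]
    refine (congrArg (fun z => ((σ (toFinsupp φ z g) y : A) : Unitization k A))
      (hs (tmul φ a 1) x q)).trans ?_
    rw [toFinsupp_tmul_mul, AlgebraAction.one_apply, inv_one, one_mul,
      hσ.map_mul, Unitization.inr_mul, smul_eq_mul]
  · exact (hT _).trans (hsum x)

lemma exact_restrict {M N K : GradedLeftModule.{max u w} (skewGrading φ 𝒜)} {f : Hom M N}
    {f' : Hom N K} (hf : Function.Exact f.toLinearMap f'.toLinearMap) :
    Function.Exact f.restrict.toLinearMap f'.restrict.toLinearMap := hf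

/-- The restriction to `A` of a linear projective resolution over `A # G`. -/
def LinearProjectiveResolution.restrict (hσ : IsRightUnitSystem 𝒜 σ e)
    {M : GradedLeftModule.{max u w} (skewGrading φ 𝒜)} (R : LinearProjectiveResolution M) :
    LinearProjectiveResolution M.restrict where
  P n := (R.P n).restrict
  projective n :=
    haveI := R.projective n
    hσ.projective_restrict (R.generated n)
  d n := (R.d n).restrict
  ε := R.ε.restrict
  exact_d n := exact_restrict (R.exact_d n)
  exact_zero := exact_restrict R.exact_zero
  surjective := R.surjective
  generated n := hσ.isGeneratedInDegree_restrict (R.generated n)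

/-- The map `a ↦ a ⊗ g` from `A₀` to the degree zero part of `A # G`. -/
def tmulDegreeZero (g : G) : 𝒜 0 →ₗ[k] skewGrading φ 𝒜 0 :=
  (tmulHom φ g).restrict fun _ ha => tmul_mem ha g

/-- The coefficient at `g`, as a map from the degree zero part of `A # G` to `A₀`. -/
def coeffDegreeZero (g : G) : skewGrading φ 𝒜 0 →ₗ[k] 𝒜 0 :=
  (Finsupp.lapply g ∘ₗ (toFinsupp φ).toLinearMap).restrict fun _ hx => mem_skewGrading.1 hx g

/-- The coefficient at `g`, as a homomorphism of graded `A`-modules. -/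
def coeffHom (h : IsPositivelyGraded 𝒜) (hs : IsPositivelyGraded (skewGrading φ 𝒜)) (g : G) :
    Hom (hs.degreeZero).restrict h.degreeZero where
  toLinearMap := linearOfCommute (M := (hs.degreeZero).restrict) (N := h.degreeZero)
    (show (hs.degreeZero).restrict →ₗ[k] h.degreeZero from coeffDegreeZero g) (fun a x => by
      refine Subtype.ext ?_
      rw [degreeZero_smul_coe, restrict_smul]
      change toFinsupp φ (((tmul φ a 1 : Unitization k (SkewGroupAlgebra φ)) •
        (show hs.degreeZero from x) : hs.degreeZero) : skewGrading φ 𝒜 0).1 g =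
          _ * toFinsupp φ (x : skewGrading φ 𝒜 0).1 g
      rw [degreeZero_smul_coe, projZero_tmul h hs, toFinsupp_tmul_mul, AlgebraAction.one_apply,
        inv_one, one_mul])
  map_deg {j x} hx := by
    rw [mem_degreeZero_deg]
    refine ((mem_degreeZero_deg hs x j).1 hx).imp id fun h0 => ?_
    rw [h0]
    exact map_zero (coeffDegreeZero g : skewGrading φ 𝒜 0 →ₗ[k] 𝒜 0)

/-- The map `a ↦ a ⊗ g` as a homomorphism of graded `A`-modules. -/
def tmulGradedHom (h : IsPositivelyGraded 𝒜) (hs : IsPositivelyGraded (skewGrading φ 𝒜)) (g : G) :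
    Hom h.degreeZero (hs.degreeZero).restrict where
  toLinearMap := linearOfCommute (M := h.degreeZero) (N := (hs.degreeZero).restrict)
    (show h.degreeZero →ₗ[k] (hs.degreeZero).restrict from tmulDegreeZero g) (fun a x => by
      refine Subtype.ext ?_
      rw [restrict_smul]
      change tmul φ (((a : Unitization k A) • x : h.degreeZero) : 𝒜 0).1 g =
        (((tmul φ a 1 : Unitization k (SkewGroupAlgebra φ)) •
        (show hs.degreeZero from tmulDegreeZero g x) : hs.degreeZero) : skewGrading φ 𝒜 0).1
      rw [degreeZero_smul_coe, degreeZero_smul_coe, projZero_tmul h hs]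
      change _ = tmul φ _ 1 * tmul φ (x : 𝒜 0).1 g
      rw [tmul_mul_tmul, AlgebraAction.one_apply, one_mul])
  map_deg {j x} hx := by
    refine (mem_degreeZero_deg hs _ j).2 ?_
    refine ((mem_degreeZero_deg h x j).1 hx).imp id fun h0 => ?_
    rw [h0]
    exact map_zero (tmulDegreeZero g : 𝒜 0 →ₗ[k] skewGrading φ 𝒜 0)

/-- If the degree zero part of `A # G` has a linear projective resolution, then so does `A₀`. -/
theorem IsRightUnitSystem.nonempty_linearProjectiveResolution (hσ : IsRightUnitSystem 𝒜 σ e)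
    (h : IsPositivelyGraded 𝒜) (hs : IsPositivelyGraded (skewGrading φ 𝒜))
    (R : LinearProjectiveResolution hs.degreeZero) :
    Nonempty (LinearProjectiveResolution h.degreeZero) := by
  -- `A₀` is the summand `A₀ ⊗ 1`, split off by the coefficient at the identity.
  refine (R.restrict hσ).of_retract h (tmulGradedHom h hs 1) (coeffHom h hs 1) fun x => ?_
  refine Subtype.ext ?_
  change toFinsupp φ (tmul φ (x : 𝒜 0).1 1) 1 = (x : 𝒜 0).1
  simp

end GradedRestriction

end KoszulCategory

namespace KoszulCategory

/-! ### Semisimplicity -/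

section Maschke

open SkewGroupAlgebra

variable {k : Type w} [Field k] {G : Type v} [Group G] [Fintype G] {A : Type u} [NonUnitalRing A]
  [Module k A] [IsScalarTower k A A] [SMulCommClass k A A] {φ : AlgebraAction k G A}
  {N : Type*} [AddCommGroup N] [Module k N] [Module (Unitization k (SkewGroupAlgebra φ)) N]
  [IsScalarTower k (Unitization k (SkewGroupAlgebra φ)) N]

/-- An `A # G`-module `N = A N` that is semisimple over `A` is semisimple. -/
theorem isSemisimpleModule_of_restriction (hcard : (Fintype.card G : k) ≠ 0)
    (ρ : G → N →ₗ[k] N) (hone : ∀ x, ρ 1 x = x) (hmul : ∀ g h x, ρ (g * h) x = ρ g (ρ h x))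
    (hsmul : ∀ a g x, (tmul φ a g : Unitization k (SkewGroupAlgebra φ)) • x =
      (tmul φ a 1 : Unitization k (SkewGroupAlgebra φ)) • ρ g x)
    (hcomm : ∀ a g x, ρ g ((tmul φ a 1 : Unitization k (SkewGroupAlgebra φ)) • x) =
      (tmul φ (φ.toHom g a) 1 : Unitization k (SkewGroupAlgebra φ)) • ρ g x)
    (hgen : AddSubgroup.closure {z : N | ∃ (a : A) (x : N),
      z = (tmul φ a 1 : Unitization k (SkewGroupAlgebra φ)) • x} = ⊤)
    (hss : letI := moduleOfAction (restrictionAction φ N)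
      IsSemisimpleModule (Unitization k A) N) :
    IsSemisimpleModule (Unitization k (SkewGroupAlgebra φ)) N := by
  let _ := moduleOfAction (restrictionAction φ N)
  have := isScalarTower_moduleOfAction (restrictionAction φ N)
  have hres : ∀ (a : A) (x : N), (a : Unitization k A) • x =
      (tmul φ a 1 : Unitization k (SkewGroupAlgebra φ)) • x :=
    moduleOfAction_smul (restrictionAction φ N)
  have hinl : ∀ (c : k) (x : N) (W : Submodule (Unitization k (SkewGroupAlgebra φ)) N),
      x ∈ W → c • x ∈ W := fun c x W hx => by
    rw [← inl_smul_eq (A := SkewGroupAlgebra φ)]; exact W.smul_mem _ hx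
  refine { toComplementedLattice := ⟨fun W => ?_⟩ }
  let W' : Submodule (Unitization k A) N :=
    { W.toAddSubmonoid with
      smul_mem' := fun r x hx => by
        induction r using Unitization.ind with
        | inl_add_inr c a =>
          rw [add_smul, inl_smul_eq, hres]
          exact W.add_mem (hinl c x W hx) (W.smul_mem _ hx) }
  obtain ⟨V, hV⟩ := exists_isCompl W'
  let p : N →ₗ[Unitization k A] N := W'.subtype ∘ₗ W'.projectionOnto V hV
  have hpW : ∀ x, p x ∈ W := fun x => (W'.projectionOnto V hV x).2
  have hpid : ∀ x ∈ W, p x = x := fun x hx =>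
    congrArg Subtype.val (Submodule.projectionOnto_apply_left hV (⟨x, hx⟩ : W'))
  -- `W` is not known to be stable under `ρ`, because `G` need not lie in `A # G`. For `x = a y`,
  -- however, `ρ g (p x) = g(a) ρ g (p y)` equals `(g(a) ⊗ g) p y`, which lies in `W`; such `x`
  -- generate `N`. Stability of `W` follows, as `p` fixes `W`.
  have hρp : ∀ g x, ρ g (p x) ∈ W := fun g x => by
    have hx : x ∈ AddSubgroup.closure {z : N | ∃ (a : A) (x : N),
      z = (tmul φ a 1 : Unitization k (SkewGroupAlgebra φ)) • x} := by rw [hgen]; trivial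
    induction hx using AddSubgroup.closure_induction with
    | mem x hx =>
      obtain ⟨a, y, rfl⟩ := hx
      rw [← hres, map_smul, hres, hcomm, ← hsmul]
      exact W.smul_mem _ (hpW y)
    | zero => simp
    | add x y _ _ hx hy => rw [map_add, map_add]; exact W.add_mem hx hy
    | neg x _ hx => rw [map_neg, map_neg]; exact W.neg_mem hx
  have hρW : ∀ g, ∀ x ∈ W, ρ g x ∈ W := fun g x hx => hpid x hx ▸ hρp g x
  -- Maschke's average of the conjugates of `p`: it commutes with `A # G` and remains a projection
  -- onto `W`.
  let q₀ : N →ₗ[k] N := (Fintype.card G : k)⁻¹ • ∑ g, ρ g ∘ₗ p.restrictScalars k ∘ₗ ρ g⁻¹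
  have hq₀ : ∀ x, q₀ x = (Fintype.card G : k)⁻¹ • ∑ g, ρ g (p (ρ g⁻¹ x)) := fun x => by
    simp [q₀]
  let q : N →ₗ[Unitization k (SkewGroupAlgebra φ)] N := linearOfCommute q₀ fun x n => by
    induction x using SkewGroupAlgebra.induction with
    | h0 => simp
    | hadd x y hx hy => rw [Unitization.inr_add, add_smul, add_smul, map_add, hx, hy]
    | ht a h =>
      rw [hq₀, hq₀, smul_algebra_smul_comm]
      congr 1
      rw [Finset.smul_sum, ← Equiv.sum_comp (Equiv.mulLeft h)]
      refine Finset.sum_congr rfl fun g _ => ?_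
      change ρ (h * g) (p (ρ (h * g)⁻¹ ((tmul φ a h : Unitization k (SkewGroupAlgebra φ)) • n))) = _
      rw [hsmul a h n, hcomm, ← hmul (h * g)⁻¹, ← hres, map_smul, hres, hcomm,
        AlgebraAction.apply_inv_self, hsmul a h, ← hmul h g, mul_inv_rev, inv_mul_cancel_right]
  have hqW : ∀ x, q x ∈ W := fun x => by
    rw [linearOfCommute_apply, hq₀]
    exact hinl _ _ W (sum_mem fun g _ => hρp g _)
  have hqid : ∀ x ∈ W, q x = x := fun x hx => by
    rw [linearOfCommute_apply, hq₀, Finset.sum_congr rfl fun g _ => by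
      rw [hpid _ (hρW _ x hx), ← hmul, mul_inv_cancel, hone]]
    rw [Finset.sum_const, Finset.card_univ, ← Nat.cast_smul_eq_nsmul k, smul_smul,
      inv_mul_cancel₀ hcard, one_smul]
  exact ⟨_, LinearMap.isCompl_of_proj (f := q.codRestrict W hqW)
    fun x => Subtype.ext (hqid x x.2)⟩

end Maschke

/-! ### Semisimplicity of the degree zero part of the skew group algebra -/

section DegreeZero

open SkewGroupAlgebra

variable {k : Type w} [Field k] {G : Type w} [Group G] [Fintype G] {A : Type (max u w)}
  [NonUnitalRing A] [Module k A] [IsScalarTower k A A] [SMulCommClass k A A]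
  {φ : AlgebraAction k G A} {𝒜 : ℕ → Submodule k A}

variable (φ) in
/-- Left multiplication by `g` on `A # G`. -/
def leftMul (g : G) : SkewGroupAlgebra φ →ₗ[k] SkewGroupAlgebra φ :=
  Finsupp.lsum k (fun h => tmulHom φ (g * h) ∘ₗ (φ.toHom g).toLinearMap) ∘ₗ
    (toFinsupp φ).toLinearMap

lemma leftMul_tmul (g : G) (a : A) (h : G) :
    leftMul φ g (tmul φ a h) = tmul φ (φ.toHom g a) (g * h) := by
  rw [leftMul, LinearMap.comp_apply, LinearEquiv.coe_coe, toFinsupp_tmul, Finsupp.lsum_single]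
  rfl

lemma leftMul_one (x : SkewGroupAlgebra φ) : leftMul φ 1 x = x := by
  induction x using SkewGroupAlgebra.induction with
  | h0 => simp
  | hadd x y hx hy => rw [map_add, hx, hy]
  | ht a g => rw [leftMul_tmul, one_mul, AlgebraAction.one_apply]

lemma leftMul_mul (g h : G) (x : SkewGroupAlgebra φ) :
    leftMul φ (g * h) x = leftMul φ g (leftMul φ h x) := by
  induction x using SkewGroupAlgebra.induction with
  | h0 => simp
  | hadd x y hx hy => simp only [map_add, hx, hy]
  | ht a g => simp only [leftMul_tmul, mul_assoc, AlgebraAction.mul_apply]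

/-- Formally `a ⊗ g = (a ⊗ 1) g`, with `leftMul` in the role of an element `g` that `A # G` may not
contain. This and `leftMul_tmul_one_mul` supply the compatibilities needed for Maschke's argument.
-/
lemma tmul_mul_eq (a : A) (g : G) (x : SkewGroupAlgebra φ) :
    tmul φ a g * x = tmul φ a 1 * leftMul φ g x := by
  induction x using SkewGroupAlgebra.induction with
  | h0 => simp
  | hadd x y hx hy => simp only [map_add, mul_add, hx, hy]
  | ht b h => simp [leftMul_tmul, tmul_mul_tmul]

lemma leftMul_tmul_one_mul (a : A) (g : G) (x : SkewGroupAlgebra φ) :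
    leftMul φ g (tmul φ a 1 * x) = tmul φ (φ.toHom g a) 1 * leftMul φ g x := by
  induction x using SkewGroupAlgebra.induction with
  | h0 => simp
  | hadd x y hx hy => simp only [map_add, mul_add, hx, hy]
  | ht b h => simp [leftMul_tmul, tmul_mul_tmul, φ.map_mul]

lemma leftMul_mem (hφ : ∀ g n, ∀ a ∈ 𝒜 n, φ.toHom g a ∈ 𝒜 n) (g : G) {n : ℕ}
    {x : SkewGroupAlgebra φ} (hx : x ∈ skewGrading φ 𝒜 n) :
    leftMul φ g x ∈ skewGrading φ 𝒜 n := by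
  induction hx using Submodule.span_induction with
  | zero => rw [map_zero]; exact zero_mem _
  | add x y _ _ hx hy => rw [map_add]; exact add_mem hx hy
  | smul c x _ hx => rw [map_smul]; exact Submodule.smul_mem _ _ hx
  | mem x hx =>
    obtain ⟨a, ha, h, rfl⟩ := hx
    rw [leftMul_tmul]
    exact tmul_mem (hφ g n a ha) _

/-- If `A₀` is semisimple and `|G|` is invertible, then the degree zero part of `A # G` is
semisimple. -/
theorem IsRightUnitSystem.isSemisimpleModule_degreeZero {X : Type*} {σ : A →ₗ[k] X →₀ A} {e : X → A}
    (hσ : IsRightUnitSystem 𝒜 σ e) (hφ : ∀ g n, ∀ a ∈ 𝒜 n, φ.toHom g a ∈ 𝒜 n)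
    (hcard : (Fintype.card G : k) ≠ 0)
    (h : IsPositivelyGraded 𝒜) (hs : IsPositivelyGraded (skewGrading φ 𝒜))
    (hss : IsSemisimpleModule (Unitization k A) h.degreeZero) :
    IsSemisimpleModule (Unitization k (SkewGroupAlgebra φ)) hs.degreeZero := by
  refine isSemisimpleModule_of_restriction hcard
    (fun g => show hs.degreeZero →ₗ[k] hs.degreeZero from
      (leftMul φ g).restrict fun _ hx => leftMul_mem hφ g hx)
    (fun x => Subtype.ext (leftMul_one _)) (fun g g' x => Subtype.ext (leftMul_mul g g' _))
    (fun a g x => Subtype.ext ?_) (fun a g x => Subtype.ext ?_) ?_ ?_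
  · rw [degreeZero_smul_coe, degreeZero_smul_coe, projZero_tmul h hs, projZero_tmul h hs]
    exact tmul_mul_eq _ _ _
  · rw [degreeZero_smul_coe, projZero_tmul h hs, projZero_apply h hφ]
    change leftMul φ g (((tmul φ a 1 : Unitization k (SkewGroupAlgebra φ)) • x : hs.degreeZero) :
      skewGrading φ 𝒜 0).1 = _
    rw [degreeZero_smul_coe, projZero_tmul h hs]
    exact leftMul_tmul_one_mul _ _ _
  · refine (AddSubgroup.eq_top_iff' _).2 fun x => ?_
    have hx : (x : skewGrading φ 𝒜 0) =
        ∑ g, tmulDegreeZero g (coeffDegreeZero g (x : skewGrading φ 𝒜 0)) := by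
      refine Subtype.ext ((toFinsupp φ).injective (Finsupp.ext fun g => ?_))
      rw [AddSubmonoidClass.coe_finsetSum, map_sum, Finsupp.finsetSum_apply,
        Finset.sum_eq_single g (fun g' _ hg => ?_) (by simp)]
      · change _ = toFinsupp φ (tmul φ (toFinsupp φ (x : skewGrading φ 𝒜 0).1 g) g) g
        rw [toFinsupp_tmul, Finsupp.single_eq_same]
      · change toFinsupp φ (tmul φ (coeffDegreeZero g' (x : skewGrading φ 𝒜 0)).1 g') g = 0
        rw [toFinsupp_tmul, Finsupp.single_eq_of_ne' hg]
    rw [show x = _ from hx]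
    refine sum_mem fun g _ => ?_
    generalize coeffDegreeZero g (x : skewGrading φ 𝒜 0) = b
    -- Extended from `A₀` to `A` through the projection, because the coefficients of `σ b` are not
    -- assumed to have degree zero.
    let L : A →ₗ[k] hs.degreeZero :=
      show A →ₗ[k] skewGrading φ 𝒜 0 from tmulDegreeZero g ∘ₗ h.projZero
    have hL : tmulDegreeZero g b = L b := by
      change _ = tmulDegreeZero g (h.projZero b)
      rw [h.projZero_of_mem_zero b.2]
    have hLe : ∀ y c, L (c * e y) = (tmul φ c 1 : Unitization k (SkewGroupAlgebra φ)) •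
        (show hs.degreeZero from tmulDegreeZero g ⟨e y, hσ.mem y⟩) := fun y c => by
      refine Subtype.ext ?_
      rw [degreeZero_smul_coe, projZero_tmul h hs]
      change tmul φ (h.projZero (c * e y) : A) g = _ * tmul φ (e y) g
      rw [h.projZero_mul, h.projZero_of_mem_zero (hσ.mem y), tmul_mul_tmul, one_mul,
        AlgebraAction.one_apply]
    rw [show (tmulDegreeZero g b : hs.degreeZero) = _ from hL, ← hσ.sum_mul b, map_finsuppSum]
    exact sum_mem fun y _ => AddSubgroup.subset_closure ⟨_, _, hLe y _⟩
  -- Over `A`, the coefficients embed `(A # G)₀` into a finite power of the semisimple module `A₀`.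
  · exact IsSemisimpleModule.of_injective (M := G → h.degreeZero) (N := hs.degreeZero.restrict)
      (LinearMap.pi fun g => (coeffHom h hs g).toLinearMap) fun x y hxy =>
      Subtype.ext ((toFinsupp φ).injective (Finsupp.ext fun g =>
        congrArg Subtype.val (congrFun hxy g)))

end DegreeZero

end KoszulCategory

namespace KoszulCategory

/-! ### Category algebras -/

section Category

variable {C : Type u} [Category.{v} C]

lemma Mor.comp?_mk {x y z : C} (f : x ⟶ y) (g : y ⟶ z) :
    Mor.comp? ⟨g⟩ ⟨f⟩ = some ⟨f ≫ g⟩ := by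
  simp [Mor.comp?]

lemma Mor.comp?_of_ne {α β : Mor C} (h : β.tgt ≠ α.src) : Mor.comp? α β = none := by
  simp [Mor.comp?, h]

/-! ### Morphisms of length zero -/

section Length

variable {l : C ⥤ SingleObj (Multiplicative ℕ)}

lemma length_id (x : C) : length l ⟨𝟙 x⟩ = 0 := by
  simp [length, gradingDeg_id]

lemma length_comp {x y z : C} (f : x ⟶ y) (g : y ⟶ z) :
    length l ⟨f ≫ g⟩ = length l ⟨g⟩ + length l ⟨f⟩ := by
  simp [length, gradingDeg_comp]

/-- The morphism `f` puts `x` and `y` in one component of the length zero subcategory, where every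
ordered pair of objects is joined by a morphism. -/
lemma IsIndiscretelyBased.exists_of_length_eq_zero (hl : IsIndiscretelyBased l) {x y : C}
    (f : x ⟶ y) (hf : length l ⟨f⟩ = 0) : ∃ g : y ⟶ x, length l ⟨g⟩ = 0 := by
  let x' : WideSubcategory (lengthZero l) := ⟨x⟩
  let y' : WideSubcategory (lengthZero l) := ⟨y⟩
  let f' : x' ⟶ y' := ⟨f, hf⟩
  let X : (CategoryTheory.ConnectedComponents.mk y').Component := ⟨x', Quotient.sound' (Zigzag.of_hom f')⟩
  let Y : (CategoryTheory.ConnectedComponents.mk y').Component := ⟨y', rfl⟩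
  obtain ⟨g⟩ := hl (CategoryTheory.ConnectedComponents.mk y') Y X
  exact ⟨g.default.hom.1, g.default.hom.2⟩

lemma IsIndiscretelyBased.hom_ext (hl : IsIndiscretelyBased l) {x y : C}
    (f g : x ⟶ y) (hf : length l ⟨f⟩ = 0) (hg : length l ⟨g⟩ = 0) : f = g := by
  let x' : WideSubcategory (lengthZero l) := ⟨x⟩
  let y' : WideSubcategory (lengthZero l) := ⟨y⟩
  let f' : x' ⟶ y' := ⟨f, hf⟩
  let g' : x' ⟶ y' := ⟨g, hg⟩
  let X : (CategoryTheory.ConnectedComponents.mk y').Component := ⟨x', Quotient.sound' (Zigzag.of_hom f')⟩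
  let Y : (CategoryTheory.ConnectedComponents.mk y').Component := ⟨y', rfl⟩
  obtain ⟨u⟩ := hl (CategoryTheory.ConnectedComponents.mk y') X Y
  have : (⟨f'⟩ : X ⟶ Y) = ⟨g'⟩ := (u.uniq _).trans (u.uniq _).symm
  exact congrArg (fun t : X ⟶ Y => t.hom.1) this

end Length

namespace CategoryAlgebra

variable {k : Type w} [Field k]

lemma of_comp {x y z : C} (f : x ⟶ y) (g : y ⟶ z) :
    of k (⟨g⟩ : Mor C) * of k ⟨f⟩ = of k ⟨f ≫ g⟩ := by
  rw [of_mul_of, Mor.comp?_mk]; rfl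

lemma of_mul_of_ne {α β : Mor C} (h : β.tgt ≠ α.src) : of k α * of k β = 0 := by
  rw [of_mul_of, Mor.comp?_of_ne h]; rfl

lemma of_mul_id (f : Mor C) : of k f * of k ⟨𝟙 f.src⟩ = of k f := by
  rcases f with ⟨f⟩
  rw [of_comp, Category.id_comp]

/-- The decomposition of the elements of the category algebra by the source of the morphisms. -/
def bySource : CategoryAlgebra C k →ₗ[k] C →₀ CategoryAlgebra C k :=
  (basis C k).constr k fun f => Finsupp.single f.src (of k f)

lemma bySource_of (f : Mor C) : bySource (of k f) = Finsupp.single f.src (of k f) :=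
  (basis C k).constr_basis k _ f

/-- This is the decomposition `a = ∑ a 1_x` over objects; it is left linear because composing on the
left does not change the source. -/
lemma isRightUnitSystem (l : C ⥤ SingleObj (Multiplicative ℕ)) :
    IsRightUnitSystem (lengthGrading k l) bySource fun x => of k ⟨𝟙 x⟩ where
  map_mul a b y := by
    induction a using CategoryAlgebra.induction with
    | h0 => simp
    | hadd a a' ha ha' => simp [add_mul, ha, ha']
    | hof c f =>
      induction b using CategoryAlgebra.induction with
      | h0 => simp
      | hadd b b' hb hb' => simp only [mul_add, map_add, Finsupp.add_apply, hb, hb']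
      | hof d g =>
        rw [smul_mul_assoc, mul_smul_comm, map_smul, map_smul, map_smul, bySource_of,
          Finsupp.smul_apply, Finsupp.smul_apply, Finsupp.smul_apply, smul_mul_assoc,
          mul_smul_comm]
        congr 2
        by_cases h : g.tgt = f.src
        · rcases g with @⟨x, y', g⟩
          rcases f with @⟨y'', z, f⟩
          dsimp only at h
          subst h
          rw [of_comp, bySource_of]
          dsimp only
          by_cases hy : x = y
          · subst hy
            rw [Finsupp.single_eq_same, Finsupp.single_eq_same, of_comp]
          · rw [Finsupp.single_eq_of_ne' hy, Finsupp.single_eq_of_ne' hy, mul_zero]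
        · rw [of_mul_of_ne h]
          by_cases hy : g.src = y
          · subst hy
            rw [Finsupp.single_eq_same, of_mul_of_ne h]
            simp
          · rw [Finsupp.single_eq_of_ne' hy]
            simp
  sum_mul a := by
    induction a using CategoryAlgebra.induction with
    | h0 => simp
    | hadd a b ha hb =>
      rw [map_add, Finsupp.sum_add_index' (by simp) (by simp [add_mul]), ha, hb]
    | hof c f =>
      rw [map_smul, bySource_of, Finsupp.smul_single, Finsupp.sum_single_index (by simp),
        smul_mul_assoc, of_mul_id]
  mem x := Submodule.subset_span ⟨_, length_id x, rfl⟩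

lemma of_mem_lengthGrading {l : C ⥤ SingleObj (Multiplicative ℕ)} {f : Mor C} {n : ℕ}
    (h : length l f = n) : of k f ∈ lengthGrading k l n :=
  Submodule.subset_span ⟨f, h, rfl⟩

lemma isPositivelyGraded (l : C ⥤ SingleObj (Multiplicative ℕ)) :
    IsPositivelyGraded (lengthGrading (C := C) k l) where
  isInternal := by
    classical
    let π : ℕ → CategoryAlgebra C k →ₗ[k] CategoryAlgebra C k := fun n =>
      (basis C k).constr k fun f => if length l f = n then of k f else 0
    have hπ : ∀ n f, π n (of k f) = if length l f = n then of k f else 0 := fun n f =>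
      (basis C k).constr_basis k _ f
    refine isInternal_of_projections ?_ π (fun i j hij x hx => ?_) (fun j x hx h0 => ?_)
    · rw [eq_top_iff]
      rintro x -
      induction x using CategoryAlgebra.induction with
      | h0 => exact zero_mem _
      | hadd a b ha hb => exact add_mem ha hb
      | hof c f =>
        exact Submodule.smul_mem _ _
          (Submodule.mem_iSup_of_mem (length l f) (of_mem_lengthGrading rfl))
    · have hle : lengthGrading k l i ≤ LinearMap.ker (π j) := by
        rw [lengthGrading, Submodule.span_le]
        rintro _ ⟨f, rfl, rfl⟩
        exact (hπ j f).trans (if_neg hij)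
      exact hle hx
    · have hle : lengthGrading k l j ≤ LinearMap.eqLocus (π j) LinearMap.id := by
        rw [lengthGrading, Submodule.span_le]
        rintro _ ⟨f, rfl, rfl⟩
        exact (hπ _ f).trans (if_pos rfl)
      exact (hle hx).symm.trans h0
  mul_mem {m n a b} ha hb := by
    induction ha using Submodule.span_induction with
    | zero => rw [zero_mul]; exact zero_mem _
    | add x y _ _ hx hy => rw [add_mul]; exact add_mem hx hy
    | smul c x _ hx => rw [smul_mul_assoc]; exact Submodule.smul_mem _ _ hx
    | mem x hx =>
      obtain ⟨f, rfl, rfl⟩ := hx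
      induction hb using Submodule.span_induction with
      | zero => rw [mul_zero]; exact zero_mem _
      | add x y _ _ hx hy => rw [mul_add]; exact add_mem hx hy
      | smul c x _ hx => rw [mul_smul_comm]; exact Submodule.smul_mem _ _ hx
      | mem y hy =>
        obtain ⟨g, rfl, rfl⟩ := hy
        by_cases h : g.tgt = f.src
        · rcases g with @⟨x, y, g⟩
          rcases f with @⟨y', z, f⟩
          dsimp only at h
          subst h
          rw [of_comp]
          exact of_mem_lengthGrading (length_comp g f)
        · rw [of_mul_of_ne h]; exact zero_mem _

/-! ### Semisimplicity of the degree zero part of the category algebra -/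

variable {l : C ⥤ SingleObj (Multiplicative ℕ)}

/-- The identity of `x` as an element of the degree zero part of the category algebra. -/
def idZero (h : IsPositivelyGraded (lengthGrading (C := C) k l)) (x : C) : h.degreeZero :=
  (⟨of k ⟨𝟙 x⟩, of_mem_lengthGrading (length_id x)⟩ : lengthGrading k l 0)

lemma coe_mem_of_mem_span_idZero (h : IsPositivelyGraded (lengthGrading (C := C) k l)) {x : C}
    {y : h.degreeZero}
    (hy : y ∈ Submodule.span (Unitization k (CategoryAlgebra C k)) {idZero h x}) :
    (y : lengthGrading k l 0).1 ∈
      Submodule.span k (basis C k '' {f : Mor C | f.src = x ∧ length l f = 0}) := by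
  obtain ⟨r, rfl⟩ := Submodule.mem_span_singleton.1 hy
  have hid : of k (⟨𝟙 x⟩ : Mor C) ∈
      Submodule.span k (basis C k '' {f : Mor C | f.src = x ∧ length l f = 0}) :=
    Submodule.subset_span ⟨_, ⟨rfl, length_id x⟩, rfl⟩
  induction r using Unitization.ind with
  | inl_add_inr c a =>
    rw [add_smul, inl_smul_eq]
    refine add_mem (Submodule.smul_mem _ c hid) ?_
    rw [degreeZero_smul_coe]
    change (h.projZero a : CategoryAlgebra C k) * of k ⟨𝟙 x⟩ ∈ _
    obtain ⟨b, hb⟩ := h.projZero a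
    change b * of k ⟨𝟙 x⟩ ∈ _
    induction hb using Submodule.span_induction with
    | zero => rw [zero_mul]; exact zero_mem _
    | add x y _ _ hx hy => rw [add_mul]; exact add_mem hx hy
    | smul c x _ hx => rw [smul_mul_assoc]; exact Submodule.smul_mem _ _ hx
    | mem z hz =>
      obtain ⟨f, hf, rfl⟩ := hz
      by_cases hx : x = f.src
      · subst hx
        rw [of_mul_id]
        exact Submodule.subset_span ⟨f, ⟨rfl, hf⟩, rfl⟩
      · rw [of_mul_of_ne hx]; exact zero_mem _

/-- Choose `f : x ⟶ z` in the support of `y` and its inverse `g` of length zero. No other length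
zero morphism from `x` ends at `z`, so `g y` is the coefficient of `f` times `1_x`; dividing by it
recovers `1_x`. -/
lemma idZero_mem_span (hl : IsIndiscretelyBased l)
    (h : IsPositivelyGraded (lengthGrading (C := C) k l)) {x : C} {y : h.degreeZero}
    (hy : y ∈ Submodule.span (Unitization k (CategoryAlgebra C k)) {idZero h x}) (hy0 : y ≠ 0) :
    idZero h x ∈ Submodule.span (Unitization k (CategoryAlgebra C k)) {y} := by
  have hyS := coe_mem_of_mem_span_idZero h hy
  have hrepr : (basis C k).repr (y : lengthGrading k l 0).1 ≠ 0 := fun h0 =>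
    hy0 (Subtype.ext ((LinearEquiv.map_eq_zero_iff _).1 h0))
  obtain ⟨f, hf⟩ := Finsupp.ne_iff.1 hrepr
  obtain ⟨hfx, hf0⟩ := ((basis C k).mem_span_image.1 hyS) (Finsupp.mem_support_iff.2 hf)
  rcases f with @⟨x', z, f⟩
  dsimp only at hfx
  subst hfx
  obtain ⟨g, hg⟩ := hl.exists_of_length_eq_zero f hf0
  have hfg : f ≫ g = 𝟙 x' :=
    hl.hom_ext _ _ (by rw [length_comp, hf0, hg]) (length_id x')
  have key : ∀ y ∈ Submodule.span k (basis C k '' {f : Mor C | f.src = x' ∧ length l f = 0}),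
      of k ⟨g⟩ * y = (basis C k).repr y ⟨f⟩ • of k ⟨𝟙 x'⟩ := fun y hy => by
    induction hy using Submodule.span_induction with
    | zero => simp
    | add y y' _ _ hy hy' => rw [mul_add, hy, hy', map_add, Finsupp.add_apply, add_smul]
    | smul c y _ hy =>
      rw [mul_smul_comm, hy, map_smul, Finsupp.smul_apply, smul_smul, smul_eq_mul]
    | mem y hy =>
      obtain ⟨f', ⟨hx, h0⟩, rfl⟩ := hy
      rcases f' with @⟨x'', z', f'⟩
      dsimp only at hx
      subst hx
      by_cases hz : z' = z
      · subst hz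
        rw [hl.hom_ext f' f h0 hf0, Module.Basis.repr_self, Finsupp.single_eq_same, one_smul,
          ← hfg, ← of_comp]
        rfl
      · rw [Module.Basis.repr_self, Finsupp.single_eq_of_ne', zero_smul]
        · exact of_mul_of_ne hz
        · intro heq
          exact hz (congrArg Mor.tgt heq)
  refine Submodule.mem_span_singleton.2 ⟨((((basis C k).repr (y : lengthGrading k l 0).1 ⟨f⟩)⁻¹ •
    of k (⟨g⟩ : Mor C) : CategoryAlgebra C k) : Unitization k (CategoryAlgebra C k)),
    Subtype.ext ?_⟩
  rw [degreeZero_smul_coe, map_smul, h.projZero_of_mem_zero (of_mem_lengthGrading hg)]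
  change (_ • of k (⟨g⟩ : Mor C)) * (y : lengthGrading k l 0).1 = of k ⟨𝟙 x'⟩
  rw [smul_mul_assoc, key _ hyS, smul_smul, inv_mul_cancel₀ hf, one_smul]

/-- Every nonzero element of `A₀ 1_x` generates `1_x`, so these modules are simple. They span `A₀`
because each morphism satisfies `f = f 1_x` with `x` its source. -/
theorem isSemisimpleModule_degreeZero (hl : IsIndiscretelyBased l)
    (h : IsPositivelyGraded (lengthGrading (C := C) k l)) :
    IsSemisimpleModule (Unitization k (CategoryAlgebra C k)) h.degreeZero := by
  have hsimple : ∀ x : C, IsSimpleModule (Unitization k (CategoryAlgebra C k))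
      (Submodule.span (Unitization k (CategoryAlgebra C k)) {idZero h x}) := fun x => by
    rw [isSimpleModule_iff_isAtom]
    refine ⟨fun hbot => ?_, fun W hW => ?_⟩
    · have h0 : idZero h x = 0 := Submodule.span_singleton_eq_bot.1 hbot
      exact (basis C k).ne_zero ⟨𝟙 x⟩ (congrArg Subtype.val h0)
    · by_contra hne
      obtain ⟨y, hyW, hy0⟩ := Submodule.exists_mem_ne_zero_of_ne_bot hne
      refine hW.not_ge (Submodule.span_singleton_le_iff_mem _ _ |>.2 ?_)
      exact (Submodule.span_singleton_le_iff_mem _ _).2 hyW (idZero_mem_span hl h (hW.le hyW) hy0)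
  refine isSemisimpleModule_of_isSemisimpleModule_submodule'
    (p := fun x : C => Submodule.span (Unitization k (CategoryAlgebra C k)) {idZero h x})
    (fun x => haveI := hsimple x; inferInstance) ?_
  rw [eq_top_iff]
  rintro ⟨x, hx⟩ -
  induction hx using Submodule.span_induction with
  | zero => exact zero_mem _
  | add x y _ _ hx hy => exact add_mem hx hy
  | smul c x hx' hx =>
    have : (c • (show h.degreeZero from (⟨x, hx'⟩ : lengthGrading k l 0)) : h.degreeZero) ∈ ⨆ x : C,
        Submodule.span (Unitization k (CategoryAlgebra C k)) {idZero h x} := by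
      rw [← inl_smul_eq (A := CategoryAlgebra C k)]
      exact Submodule.smul_mem _ _ hx
    exact this
  | mem x hx =>
    obtain ⟨f, hf, rfl⟩ := hx
    refine Submodule.mem_iSup_of_mem f.src (Submodule.mem_span_singleton.2
      ⟨(of k f : Unitization k (CategoryAlgebra C k)), Subtype.ext ?_⟩)
    rw [degreeZero_smul_coe, h.projZero_of_mem_zero (of_mem_lengthGrading hf)]
    exact of_mul_id f

end CategoryAlgebra

end Category

/-- Let `A` be a positively graded algebra with a right unit system and with `A₀` semisimple, and
let `G` be a finite group of graded automorphisms of `A` whose order is invertible.  Then `A` is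
Koszul if and only if `A # G` is. -/
theorem isKoszul_iff_isKoszul_skewGrading {k : Type w} [Field k] {G : Type w} [Group G] [Fintype G]
    {A : Type (max u w)} [NonUnitalRing A] [Module k A] [IsScalarTower k A A] [SMulCommClass k A A]
    {φ : AlgebraAction k G A} {𝒜 : ℕ → Submodule k A} {X : Type*} {σ : A →ₗ[k] X →₀ A} {e : X → A}
    (hσ : IsRightUnitSystem 𝒜 σ e) (hφ : ∀ g n, ∀ a ∈ 𝒜 n, φ.toHom g a ∈ 𝒜 n)
    (hcard : (Fintype.card G : k) ≠ 0) (h : IsPositivelyGraded 𝒜)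
    (hss : IsSemisimpleModule (Unitization k A) h.degreeZero) :
    IsKoszul 𝒜 ↔ IsKoszul (skewGrading φ 𝒜) := by
  have hs := SkewGroupAlgebra.isPositivelyGraded (φ := φ) h hφ
  constructor
  · rintro ⟨_, _, ⟨R⟩⟩
    exact ⟨hs, hσ.isSemisimpleModule_degreeZero hφ hcard h hs hss, ⟨R.induced hφ h hs⟩⟩
  · rintro ⟨_, _, ⟨R⟩⟩
    exact ⟨h, hss, hσ.nonempty_linearProjectiveResolution h hs R⟩

end KoszulCategory
end

theorem mainTheorem8 {k : Type w} [Field k] (n : ℕ)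
    (G : Subgroup (Matrix.GeneralLinearGroup (Fin n) k)) [Finite G]
    (hdiag : ∀ g ∈ G, (g : Matrix (Fin n) (Fin n) k).IsDiag)
    (hchar : ¬ ringChar k ∣ Nat.card G)
    {C : Type u} [Category.{v} C]
    (l : C ⥤ SingleObj (Multiplicative ℕ)) (hl : IsIndiscretelyBased l)
    (deg : C ⥤ SingleObj (G →* kˣ))
    (φ : AlgebraAction k G (CategoryAlgebra C k))
    (hφ : ∀ (g : G) (f : Mor C), φ.toHom g (CategoryAlgebra.of k f) =
      (gradingDeg deg f g⁻¹ : k) • CategoryAlgebra.of k f) :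
    IsKoszul (lengthGrading k l) ↔ IsKoszul (skewGrading φ (lengthGrading k l)) := by
  have := Fintype.ofFinite G
  refine isKoszul_iff_isKoszul_skewGrading.{max u v, w} (CategoryAlgebra.isRightUnitSystem l)
    (fun g n a ha => ?_) ?_ (CategoryAlgebra.isPositivelyGraded l)
    (CategoryAlgebra.isSemisimpleModule_degreeZero hl _)
  · induction ha using Submodule.span_induction with
    | zero => rw [map_zero]; exact zero_mem _
    | add x y _ _ hx hy => rw [map_add]; exact add_mem hx hy
    | smul c x _ hx => rw [map_smul]; exact Submodule.smul_mem _ _ hx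
    | mem x hx =>
      obtain ⟨f, hf, rfl⟩ := hx
      -- A morphism is only multiplied by a scalar, so its length is unchanged.
      rw [hφ]
      exact Submodule.smul_mem _ _ (CategoryAlgebra.of_mem_lengthGrading hf)
  · rwa [Ne, ringChar.spec, ← Nat.card_eq_fintype_card]
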